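/- Let $s,t>1$ be coprime integers. A partition is identified with its Young diagram; $|\lambda|$ denotes the size of $\lambda$ and $\lambda'$ its conjugate (obtained by reflecting the Young diagram in the main diagonal), and $\lambda$ is self-conjugate if $\lambda=\lambda'$. The rim of $\lambda$ is the set of nodes $(r,c)$ of $\lambda$ such that $(r+1,c+1)$ is not a node of $\lambda$; a rim $s$-hook of $\lambda$ is a connected set of $s$ nodes of the rim whose removal leaves the Young diagram of a partition. The $s$-core $\operatorname{cor}_s(\lambda)$ is the partition obtained from $\lambda$ by repeatedly removing rim $s$-hooks until none remain (it does not depend on the choices made), and the $s$-weight $\operatorname{wei}_s(\lambda)$ is the number of rim $s$-hooks removed in this process. Theorem. For every partition $\lambda$ the following are equivalent. 1. $\lambda\neq\lambda'$, and the set of partitions $\mu$ with $|\mu|=|\lambda|$, $\operatorname{cor}_s(\mu)=\operatorname{cor}_s(\lambda)$ and $\operatorname{cor}_t(\mu)=\operatorname{cor}_t(\lambda)$ is exactly $\{\lambda,\lambda'\}$. 2. $\operatorname{cor}_s(\lambda)$ and $\operatorname{cor}_t(\lambda)$ are both self-conjugate, and $$\operatorname{wei}_s(\lambda)-\operatorname{wei}_s(\operatorname{cor}_t(\lambda))=\operatorname{wei}_t(\lambda)-\operatorname{wei}_t(\operatorname{cor}_s(\lambda))=1.$$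 -/

import Mathlib

/-- The graph on the positions `(row, column)` in which two positions are adjacent when the
corresponding boxes share an edge. -/
def nodeGraph : SimpleGraph (ℕ × ℕ) where
  Adj a b :=
    (a.1 = b.1 ∧ (a.2 + 1 = b.2 ∨ b.2 + 1 = a.2)) ∨
      (a.2 = b.2 ∧ (a.1 + 1 = b.1 ∨ b.1 + 1 = a.1))
  symm := ⟨by
    rintro ⟨a, b⟩ ⟨c, d⟩ h
    simp only at h ⊢
    omega⟩
  loopless := ⟨by
    rintro ⟨a, b⟩ h
    simp only at h
    omega⟩

/-- The rim of a Young diagram: the nodes `(r, c)` for which `(r + 1, c + 1)` is not a node. -/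
def rim (lam : YoungDiagram) : Finset (ℕ × ℕ) :=
  lam.cells.filter (fun x => (x.1 + 1, x.2 + 1) ∉ lam)

/-- `RemovesRimHook s lam mu`: the Young diagram `mu` is obtained from `lam` by removing
a rim `s`-hook, i.e. a connected set `H` of `s` nodes in the rim of `lam`. -/
def RemovesRimHook (s : ℕ) (lam mu : YoungDiagram) : Prop :=
  ∃ H : Finset (ℕ × ℕ), H ⊆ rim lam ∧ H.card = s ∧
    (nodeGraph.induce (H : Set (ℕ × ℕ))).Connected ∧ mu.cells = lam.cells \ H

/-- A partition is an `s`-core if it has no rim `s`-hooks. -/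
def IsCore (s : ℕ) (lam : YoungDiagram) : Prop :=
  ∀ mu : YoungDiagram, ¬ RemovesRimHook s lam mu

/-- `RemovesRimHooks s n lam mu`: one can go from `lam` to `mu` by successively removing
exactly `n` rim `s`-hooks. -/
inductive RemovesRimHooks (s : ℕ) : ℕ → YoungDiagram → YoungDiagram → Prop
  | refl (lam : YoungDiagram) : RemovesRimHooks s 0 lam lam
  | step {n : ℕ} {lam mu nu : YoungDiagram} (h : RemovesRimHook s lam mu)
      (h' : RemovesRimHooks s n mu nu) : RemovesRimHooks s (n + 1) lam nu

theorem RemovesRimHook.card_lt {s : ℕ} {lam mu : YoungDiagram} (h : RemovesRimHook s lam mu) :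
    mu.card < lam.card := by
  obtain ⟨H, hH, -, hc, hmu⟩ := h
  obtain ⟨x, hx⟩ := hc.nonempty
  have hx' : x ∈ lam.cells := (Finset.mem_filter.1 (hH (Finset.mem_coe.1 hx))).1
  refine Finset.card_lt_card ?_
  rw [hmu]
  refine Finset.ssubset_iff_subset_ne.2 ⟨Finset.sdiff_subset, fun he => ?_⟩
  rw [← he] at hx'
  exact (Finset.mem_sdiff.1 hx').2 (Finset.mem_coe.1 hx)

/-- Rim `s`-hooks can be removed from a partition until none remain. -/
theorem exists_core_weight (s : ℕ) (lam : YoungDiagram) :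
    ∃ p : YoungDiagram × ℕ, IsCore s p.1 ∧ RemovesRimHooks s p.2 lam p.1 := by
  induction hk : lam.card using Nat.strong_induction_on generalizing lam with
  | _ k ih =>
    by_cases h : IsCore s lam
    · exact ⟨(lam, 0), h, .refl lam⟩
    · unfold IsCore at h
      push Not at h
      obtain ⟨mu, hmu⟩ := h
      obtain ⟨⟨nu, n⟩, h1, h2⟩ := ih mu.card (hk ▸ hmu.card_lt) mu rfl
      exact ⟨(nu, n + 1), h1, .step hmu h2⟩

/-- The `s`-core of `lam`: the partition reached by removing rim `s`-hooks until none remain.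
(The result does not depend on the hooks removed, so the choice made here is immaterial.) -/
noncomputable def core (s : ℕ) (lam : YoungDiagram) : YoungDiagram :=
  (exists_core_weight s lam).choose.1

/-- The `s`-weight of `lam`: the number of rim `s`-hooks removed to reach the `s`-core. -/
noncomputable def weight (s : ℕ) (lam : YoungDiagram) : ℕ :=
  (exists_core_weight s lam).choose.2

/-- A partition is self-conjugate if it equals its conjugate. -/
def IsSelfConjugate (lam : YoungDiagram) : Prop :=
  lam.transpose = lam

/-! A partition is encoded by beads on ℤ. Removing a rim `s`-hook moves a bead from `b` to a gap `b
- s`, so the `s`-core records the number of beads in each class modulo `s`, and the `s`-weight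
counts pairs of a gap and a later bead in one class. Two partitions share size and cores iff their
difference is orthogonal to the identity and to all `s`- and `t`-periodic functions.

Call classes modulo `t` columns and classes modulo `s` rows. Shift one column onto another by a
multiple `h` of `s`; `excess` collects the beads of one that face gaps of the other. The difference
of the two excesses depends only on the `t`-core, where one of them is empty. Hence the `s`-weight
of `lam` minus that of its `t`-core is the sum of the smaller excesses over all pairs of columns; it
is one iff a single pair crosses, with smaller excess one (`ncard_inversions_sub_eq_one_iff`).

A crossing with `t ∤ h` yields two beads and two gaps whose exchange preserves size and cores
(`IsQuad.exists_eq_exchange`). Conversely, if crossing columns always have equal excesses, the beads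
of each row sit in its highest columns; by a rearrangement argument, configurations with the same
data differ only at ties of height (`IsMayaCore.exists_crossed`).

If there is just one other partition, some columns cross, every quad has the same corners, and
crossings with `t ∣ h` are excluded because the columns concerned are closed under subtracting `s *
t`. If both weight differences are one, the crossing of columns and the crossing of rows pin down
one quad, whose exchange is the only alternative. Self-conjugate cores make the conjugate a
candidate, and it differs from `lam` because otherwise the exchange would be symmetric under `x ↦ -1
- x`. -/

open Finsupp

/-! ### Diagonals of a Young diagram -/

/-- The content of a node: its column index minus its row index. -/
def content (x : ℕ × ℕ) : ℤ := (x.2 : ℤ) - x.1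

/-- The number of nodes of content `d`. -/
def diagLen (lam : YoungDiagram) (d : ℤ) : ℕ := (lam.cells.filter (fun x => content x = d)).card

theorem eq_of_content_eq {x y : ℕ × ℕ} (h : content x = content y)
    (h' : min x.1 x.2 = min y.1 y.2) : x = y := by
  obtain ⟨a, b⟩ := x
  obtain ⟨c, d⟩ := y
  simp only [content] at h h'
  ext <;> simp <;> omega

theorem diagLen_eq_of_mem_iff {lam : YoungDiagram} {d : ℤ} {n : ℕ}
    (h : ∀ x, content x = d → (x ∈ lam ↔ min x.1 x.2 < n)) : diagLen lam d = n := by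
  have : lam.cells.filter (fun x => content x = d) =
      (Finset.range n).image (fun k => (k + (-d).toNat, k + d.toNat)) := by
    ext x
    simp only [Finset.mem_filter, YoungDiagram.mem_cells, Finset.mem_image, Finset.mem_range]
    constructor
    · rintro ⟨hx, hd⟩
      refine ⟨min x.1 x.2, (h x hd).1 hx, ?_⟩
      obtain ⟨a, b⟩ := x
      simp only [content] at hd
      ext <;> simp <;> omega
    · rintro ⟨k, hk, rfl⟩
      have hc : content (k + (-d).toNat, k + d.toNat) = d := by
        simp only [content]; push_cast; omega
      refine ⟨(h _ hc).2 ?_, hc⟩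
      simp only
      omega
  rw [diagLen, this, Finset.card_image_of_injective, Finset.card_range]
  intro a b hab
  simp only [Prod.mk.injEq] at hab
  omega

/-- A Young diagram is a lower set, so it meets each diagonal in an initial segment. Diagonal
lengths therefore determine the diagram. -/
theorem mem_iff_lt_diagLen (lam : YoungDiagram) (x : ℕ × ℕ) :
    x ∈ lam ↔ min x.1 x.2 < diagLen lam (content x) := by
  suffices H : ∀ d : ℤ, ∃ n, ∀ x, content x = d → (x ∈ lam ↔ min x.1 x.2 < n) by
    obtain ⟨n, hn⟩ := H (content x)
    rw [diagLen_eq_of_mem_iff hn, hn x rfl]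
  intro d
  have hex : ∃ k : ℕ, (k + (-d).toNat, k + d.toNat) ∉ lam := by
    refine ⟨lam.rowLen 0, fun hk => ?_⟩
    have h1 := YoungDiagram.mem_iff_lt_rowLen.1 hk
    have h2 := lam.rowLen_anti 0 (lam.rowLen 0 + (-d).toNat) (Nat.zero_le _)
    omega
  classical
  refine ⟨Nat.find hex, fun x hx => ?_⟩
  have hxe : x = (min x.1 x.2 + (-d).toNat, min x.1 x.2 + d.toNat) := by
    obtain ⟨a, b⟩ := x
    simp only [content] at hx
    ext <;> simp <;> omega
  constructor
  · intro hm
    by_contra hlt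
    apply Nat.find_spec hex
    exact lam.isLowerSet (Prod.mk_le_mk.2 ⟨by omega, by omega⟩) (hxe ▸ hm)
  · intro hm
    rw [hxe]
    exact not_not.1 (Nat.find_min hex hm)

theorem diagLen_step_of_nonneg (lam : YoungDiagram) {d : ℤ} (hd : 0 ≤ d) :
    diagLen lam (d + 1) ≤ diagLen lam d ∧ diagLen lam d ≤ diagLen lam (d + 1) + 1 := by
  obtain ⟨k, rfl⟩ := Int.eq_ofNat_of_zero_le hd
  have key : ∀ n m : ℕ, (n, n + m) ∈ lam ↔ n < diagLen lam m := by
    intro n m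
    have := mem_iff_lt_diagLen lam (n, n + m)
    simpa [content] using this
  have key' : ∀ n, (n, n + k + 1) ∈ lam ↔ n < diagLen lam (k + 1) := by
    intro n
    exact_mod_cast key n (k + 1)
  constructor
  · by_contra! hlt
    have h1 := (key' (diagLen lam k)).2 (by exact_mod_cast hlt)
    have h2 := (key (diagLen lam k) k).1
      (lam.isLowerSet (Prod.mk_le_mk.2 ⟨le_rfl, by omega⟩) h1)
    omega
  · by_contra! hlt
    have h1 := (key (diagLen lam (k + 1) + 1) k).2 (by exact_mod_cast hlt)
    have h2 := (key' (diagLen lam (k + 1))).1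
      (lam.isLowerSet (Prod.mk_le_mk.2 ⟨by omega, by omega⟩) h1)
    omega

theorem diagLen_transpose (lam : YoungDiagram) (d : ℤ) :
    diagLen lam.transpose d = diagLen lam (-d) := by
  refine diagLen_eq_of_mem_iff fun x hx => ?_
  rw [YoungDiagram.mem_transpose, mem_iff_lt_diagLen, ← hx]
  simp only [content, Prod.swap, neg_sub, min_comm]

theorem diagLen_step_of_neg (lam : YoungDiagram) {d : ℤ} (hd : d < 0) :
    diagLen lam d ≤ diagLen lam (d + 1) ∧ diagLen lam (d + 1) ≤ diagLen lam d + 1 := by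
  have := diagLen_step_of_nonneg lam.transpose (d := -d - 1) (by omega)
  simp only [diagLen_transpose] at this
  convert this using 3 <;> ring_nf

/-! ### Maya diagrams -/

/-- The difference between the bead configuration (Maya diagram) of `lam`
and that of the empty partition. -/
noncomputable def maya (lam : YoungDiagram) : ℤ →₀ ℤ :=
  ∑ x ∈ lam.cells, (single (content x) 1 - single (content x - 1) 1)

/-- `occ e x` is the number of beads at position `x` of the configuration obtained by adding `e`
to the configuration of the empty partition. -/
def occ (e : ℤ →₀ ℤ) (x : ℤ) : ℤ := e x + if x < 0 then 1 else 0

/-- All positions hold no bead or one bead. -/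
def IsMaya (e : ℤ →₀ ℤ) : Prop := ∀ x, occ e x = 0 ∨ occ e x = 1

theorem linearCombination_indicator (e : ℤ →₀ ℤ) (x : ℤ) :
    linearCombination ℤ (fun y : ℤ => if y = x then (1 : ℤ) else 0) e = e x := by
  rw [linearCombination_apply, Finsupp.sum]
  simp +contextual [eq_comm]

/-- Test functions read off invariants: constants give total zero, the identity gives the size, the
indicator of `[d, ∞)` gives a diagonal length. -/
theorem linearCombination_maya (lam : YoungDiagram) (φ : ℤ → ℤ) :
    linearCombination ℤ φ (maya lam) =
      ∑ x ∈ lam.cells, (φ (content x) - φ (content x - 1)) := by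
  simp [maya, map_sum]

theorem linearCombination_maya_one (lam : YoungDiagram) :
    linearCombination ℤ (fun _ => (1 : ℤ)) (maya lam) = 0 := by
  simp [linearCombination_maya]

theorem linearCombination_maya_id (lam : YoungDiagram) :
    linearCombination ℤ (fun x : ℤ => x) (maya lam) = lam.card := by
  simp [linearCombination_maya, YoungDiagram.card]

theorem linearCombination_maya_le (lam : YoungDiagram) (d : ℤ) :
    linearCombination ℤ (fun x : ℤ => if d ≤ x then (1 : ℤ) else 0) (maya lam) =
      diagLen lam d := by
  rw [linearCombination_maya, diagLen, Finset.card_filter]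
  push_cast
  refine Finset.sum_congr rfl fun x _ => ?_
  split_ifs <;> omega

theorem maya_apply (lam : YoungDiagram) (x : ℤ) :
    maya lam x = diagLen lam x - diagLen lam (x + 1) := by
  have h : maya lam x = linearCombination ℤ (fun y : ℤ => if y = x then (1 : ℤ) else 0)
      (maya lam) :=
    (linearCombination_indicator _ _).symm
  rw [h, linearCombination_maya, diagLen, diagLen, Finset.card_filter, Finset.card_filter]
  push_cast
  rw [← Finset.sum_sub_distrib]
  refine Finset.sum_congr rfl fun y _ => ?_
  congr 1
  simp only [sub_eq_iff_eq_add]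

theorem isMaya_maya (lam : YoungDiagram) : IsMaya (maya lam) := by
  intro x
  rw [occ, maya_apply]
  split_ifs with h
  · have := diagLen_step_of_neg lam h
    omega
  · have := diagLen_step_of_nonneg lam (not_lt.1 h)
    omega

theorem maya_injective : Function.Injective maya := by
  intro lam mu h
  ext x
  have : diagLen lam (content x) = diagLen mu (content x) := by
    have := linearCombination_maya_le lam (content x)
    rw [h, linearCombination_maya_le] at this
    exact_mod_cast this.symm
  rw [YoungDiagram.mem_cells, YoungDiagram.mem_cells, mem_iff_lt_diagLen, mem_iff_lt_diagLen, this]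

/-- Conjugation reflects positions by `x ↦ -1 - x` and swaps beads with gaps. -/
theorem maya_transpose (lam : YoungDiagram) (x : ℤ) :
    maya lam.transpose x = -maya lam (-1 - x) := by
  simp only [maya_apply, diagLen_transpose]
  ring_nf

theorem linearCombination_sub_fun (e : ℤ →₀ ℤ) (φ ψ : ℤ → ℤ) :
    linearCombination ℤ (fun x => φ x - ψ x) e =
      linearCombination ℤ φ e - linearCombination ℤ ψ e := by
  simp [linearCombination_apply, Finsupp.sum, mul_sub]

/-- The diagonal lengths must be the totals `n d` of `e` on `[d, ∞)`. As the whole total vanishes,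
`n d` counts beads from `d` on when `0 ≤ d` and gaps before `d` when `d < 0`; both are nonnegative
and vanish far out. -/
theorem exists_maya_eq {e : ℤ →₀ ℤ} (he : IsMaya e)
    (h0 : linearCombination ℤ (fun _ => (1 : ℤ)) e = 0) : ∃ lam, maya lam = e := by
  set n : ℤ → ℤ := fun d => linearCombination ℤ (fun x : ℤ => if d ≤ x then (1 : ℤ) else 0) e
    with hn
  have hn' : ∀ d, n d = -linearCombination ℤ (fun x : ℤ => if x < d then (1 : ℤ) else 0) e := by
    intro d
    rw [← zero_sub, ← h0, ← linearCombination_sub_fun, hn]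
    simp only
    congr 2
    funext x
    split_ifs <;> omega
  have hstep : ∀ d, n d - n (d + 1) = e d := by
    intro d
    rw [← linearCombination_indicator e d, hn]
    simp only
    rw [← linearCombination_sub_fun]
    congr 1
    congr 1
    funext x
    split_ifs <;> omega
  have hpos : ∀ d, 0 ≤ n d := by
    intro d
    rcases le_or_gt 0 d with hd | hd
    · rw [hn]
      simp only [linearCombination_apply, Finsupp.sum, smul_eq_mul]
      refine Finset.sum_nonneg fun x _ => ?_
      have := he x
      rw [occ] at this
      split_ifs at this ⊢ <;> omega
    · rw [hn']
      simp only [linearCombination_apply, Finsupp.sum, smul_eq_mul, ← Finset.sum_neg_distrib]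
      refine Finset.sum_nonneg fun x _ => ?_
      have := he x
      rw [occ] at this
      split_ifs at this ⊢ <;> omega
  obtain ⟨N, hN⟩ : ∃ N : ℤ, ∀ d, n d ≠ 0 → -N ≤ d ∧ d ≤ N := by
    refine ⟨∑ x ∈ e.support, |x|, fun d hd => ?_⟩
    have hb : ∀ x, e x ≠ 0 → |x| ≤ ∑ x ∈ e.support, |x| := fun x hx =>
      Finset.single_le_sum (f := fun x : ℤ => |x|) (fun _ _ => abs_nonneg _)
        (Finsupp.mem_support_iff.2 hx)
    by_contra hcon
    rw [not_and_or, not_le, not_le] at hcon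
    apply hd
    rcases hcon with hcon | hcon
    · rw [hn']
      simp only [linearCombination_apply, Finsupp.sum, smul_eq_mul]
      rw [neg_eq_zero]
      refine Finset.sum_eq_zero fun x hx => ?_
      have := hb x (Finsupp.mem_support_iff.1 hx)
      have := neg_abs_le x
      rw [if_neg (by omega), mul_zero]
    · rw [hn]
      simp only [linearCombination_apply, Finsupp.sum, smul_eq_mul]
      refine Finset.sum_eq_zero fun x hx => ?_
      have := hb x (Finsupp.mem_support_iff.1 hx)
      have := le_abs_self x
      rw [if_neg (by omega), mul_zero]
  set S : Finset (ℕ × ℕ) := (Finset.Icc (-N) N).biUnion fun d =>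
    (Finset.range (n d).toNat).image (fun k => (k + (-d).toNat, k + d.toNat)) with hS
  have hmem : ∀ x, x ∈ S ↔ ((min x.1 x.2 : ℕ) : ℤ) < n (content x) := by
    intro x
    simp only [hS, Finset.mem_biUnion, Finset.mem_Icc, Finset.mem_image, Finset.mem_range]
    constructor
    · rintro ⟨d, -, k, hk, rfl⟩
      have hc : content (k + (-d).toNat, k + d.toNat) = d := by
        simp only [content]; push_cast; omega
      rw [hc]
      simp only
      omega
    · intro hx
      refine ⟨content x, hN _ (by omega), min x.1 x.2, by omega, ?_⟩
      obtain ⟨a, b⟩ := x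
      simp only [content]
      ext <;> simp <;> omega
  have hlow : IsLowerSet (S : Set (ℕ × ℕ)) := by
    have hr : ∀ r c, (r, c + 1) ∈ S → (r, c) ∈ S := by
      intro r c
      rw [hmem, hmem]
      have h1 := hstep (content (r, c))
      have h2 := he (content (r, c))
      have h3 : content (r, c + 1) = content (r, c) + 1 := by simp [content]; ring
      rw [occ] at h2
      rw [h3]
      simp only [content] at *
      split_ifs at h2 <;> omega
    have hd : ∀ r c, (r + 1, c) ∈ S → (r, c) ∈ S := by
      intro r c
      rw [hmem, hmem]
      have h1 := hstep (content (r + 1, c))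
      have h2 := he (content (r + 1, c))
      have h3 : content (r, c) = content (r + 1, c) + 1 := by simp [content]; ring
      rw [occ] at h2
      rw [h3]
      simp only [content] at *
      push_cast at *
      split_ifs at h2 <;> omega
    have hr' : ∀ r c k, (r, c + k) ∈ S → (r, c) ∈ S := by
      intro r c k
      induction k with
      | zero => exact id
      | succ k ih => exact fun h => ih (hr r (c + k) h)
    have hd' : ∀ r c k, (r + k, c) ∈ S → (r, c) ∈ S := by
      intro r c k
      induction k with
      | zero => exact id
      | succ k ih => exact fun h => ih (hd (r + k) c h)
    rintro ⟨a, b⟩ ⟨r, c⟩ hle hab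
    obtain ⟨h1, h2⟩ := Prod.mk_le_mk.1 hle
    obtain ⟨k, rfl⟩ := Nat.exists_eq_add_of_le h1
    obtain ⟨l, rfl⟩ := Nat.exists_eq_add_of_le h2
    exact hr' _ _ l (hd' _ _ k hab)
  refine ⟨⟨S, hlow⟩, ?_⟩
  have hdl : ∀ d, (diagLen ⟨S, hlow⟩ d : ℤ) = n d := by
    intro d
    rw [diagLen_eq_of_mem_iff (n := (n d).toNat), Int.toNat_of_nonneg (hpos d)]
    intro x hx
    rw [← YoungDiagram.mem_cells, hmem, hx]
    omega
  ext x
  rw [maya_apply, hdl, hdl, hstep]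

/-! ### Rim hooks as bead moves -/

theorem content_injOn_rim (lam : YoungDiagram) : Set.InjOn content (rim lam : Set (ℕ × ℕ)) := by
  have key : ∀ x ∈ rim lam, ∀ y ∈ rim lam, content x = content y →
      min y.1 y.2 ≤ min x.1 x.2 := by
    intro x hx y hy h
    by_contra! hlt
    simp only [rim, Finset.mem_filter, YoungDiagram.mem_cells] at hx hy
    refine hx.2 (lam.isLowerSet (Prod.mk_le_mk.2 ⟨?_, ?_⟩) hy.1)
    all_goals simp only [content] at h; omega
  intro x hx y hy h
  exact eq_of_content_eq h (le_antisymm (key y hy x hx h.symm) (key x hx y hy h))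

theorem exists_content_eq_of_walk {H : Set (ℕ × ℕ)} {u v : H}
    (p : (nodeGraph.induce H).Walk u v) {m : ℤ} (h1 : content u ≤ m) (h2 : m ≤ content v) :
    ∃ w : H, content w = m := by
  induction p with
  | nil => exact ⟨_, le_antisymm h1 h2⟩
  | @cons u w v h p ih =>
    by_cases hw : content w ≤ m
    · exact ih hw h2
    · refine ⟨u, ?_⟩
      simp only [SimpleGraph.comap_adj, nodeGraph, Function.Embedding.subtype_apply] at h
      simp only [content] at *
      omega

/-- Content changes by one along an edge, so a connected set takes an interval of contents. The
interval is half-open so that the contributions of its nodes telescope to the move from `b` to `b -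
H.card`. -/
theorem exists_image_content_eq {H : Finset (ℕ × ℕ)}
    (hc : (nodeGraph.induce (H : Set (ℕ × ℕ))).Connected)
    (hinj : Set.InjOn content (H : Set (ℕ × ℕ))) :
    ∃ b : ℤ, H.image content = Finset.Ioc (b - H.card) b := by
  obtain ⟨⟨x, hx⟩⟩ := hc.nonempty
  have hne : (H.image content).Nonempty := ⟨content x, Finset.mem_image_of_mem _ hx⟩
  set a := (H.image content).min' hne
  set b := (H.image content).max' hne
  have hI : H.image content = Finset.Icc a b := by
    ext m
    constructor
    · exact fun hm => Finset.mem_Icc.2 ⟨Finset.min'_le _ _ hm, Finset.le_max' _ _ hm⟩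
    · intro hm
      obtain ⟨h1, h2⟩ := Finset.mem_Icc.1 hm
      obtain ⟨u, hu, hua⟩ := Finset.mem_image.1 ((H.image content).min'_mem hne)
      obtain ⟨v, hv, hvb⟩ := Finset.mem_image.1 ((H.image content).max'_mem hne)
      obtain ⟨p⟩ := hc.preconnected ⟨u, hu⟩ ⟨v, hv⟩
      obtain ⟨w, hw⟩ := exists_content_eq_of_walk p (hua.trans_le h1) (h2.trans_eq hvb.symm)
      exact Finset.mem_image.2 ⟨w, w.2, hw⟩
  have hcard : (H.card : ℤ) = b + 1 - a := by
    rw [← Finset.card_image_of_injOn hinj, hI, Int.card_Icc]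
    have : a ≤ b := Finset.min'_le_max' _ hne
    omega
  refine ⟨b, ?_⟩
  rw [hI]
  ext m
  simp only [Finset.mem_Icc, Finset.mem_Ioc]
  omega

theorem sum_Ioc_single_sub (b : ℤ) (n : ℕ) :
    ∑ d ∈ Finset.Ioc (b - n) b, (single d (1 : ℤ) - single (d - 1) 1) =
      single b 1 - single (b - n) 1 := by
  induction n with
  | zero => simp
  | succ n ih =>
    have : Finset.Ioc (b - (n + 1 : ℕ)) b = insert (b - n) (Finset.Ioc (b - n) b) := by
      ext m
      simp only [Finset.mem_insert, Finset.mem_Ioc]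
      omega
    rw [this, Finset.sum_insert (by simp), ih]
    have : b - (n : ℤ) - 1 = b - (n + 1 : ℕ) := by push_cast; ring
    rw [this]
    abel

/-- `MovesBead s e e'`: the configuration `e'` arises from `e` by moving a bead from a position
`b` to the free position `b - s`. -/
def MovesBead (s : ℕ) (e e' : ℤ →₀ ℤ) : Prop :=
  ∃ b : ℤ, occ e b = 1 ∧ occ e (b - s) = 0 ∧ e' = e - single b 1 + single (b - s) 1

theorem RemovesRimHook.movesBead {s : ℕ} (hs : 0 < s) {lam mu : YoungDiagram}
    (h : RemovesRimHook s lam mu) : MovesBead s (maya lam) (maya mu) := by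
  obtain ⟨H, hH, rfl, hc, hmu⟩ := h
  have hinj : Set.InjOn content (H : Set (ℕ × ℕ)) :=
    (content_injOn_rim lam).mono (by exact_mod_cast hH)
  obtain ⟨b, hb⟩ := exists_image_content_eq hc hinj
  have hsub : H ⊆ lam.cells := hH.trans (Finset.filter_subset _ _)
  have he : maya mu = maya lam - single b 1 + single (b - H.card) 1 := by
    have h1 : maya mu + ∑ x ∈ H, (single (content x) 1 - single (content x - 1) 1) = maya lam := by
      rw [maya, hmu, maya, Finset.sum_sdiff hsub]
    have h2 : ∑ x ∈ H, (single (content x) (1 : ℤ) - single (content x - 1) 1) =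
        single b 1 - single (b - H.card) 1 := by
      rw [← sum_Ioc_single_sub, ← hb, Finset.sum_image hinj]
    rw [← h1, h2]
    abel
  have hne : b - (H.card : ℤ) ≠ b := by omega
  refine ⟨b, ?_, ?_, he⟩
  -- Occupation numbers are 0 or 1 before and after, and this one drops, so `b` held a bead.
  · have h1 := isMaya_maya lam b
    have h2 := isMaya_maya mu b
    rw [occ, he] at h2
    simp [hne] at h2
    rw [occ] at h1 ⊢
    omega
  · have h1 := isMaya_maya lam (b - H.card)
    have h2 := isMaya_maya mu (b - H.card)
    rw [occ, he] at h2
    simp [hne.symm] at h2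
    rw [occ] at h1 ⊢
    omega

theorem diagLen_of_maya_eq {lam mu : YoungDiagram} {b : ℤ} {s : ℕ}
    (h : maya mu = maya lam - single b 1 + single (b - s) 1) (d : ℤ) :
    (diagLen lam d : ℤ) = diagLen mu d + if b - s < d ∧ d ≤ b then 1 else 0 := by
  rw [← linearCombination_maya_le, ← linearCombination_maya_le, h]
  simp only [map_add, map_sub, linearCombination_single, one_smul]
  split_ifs <;> omega

theorem removesRimHook_of_maya_eq {s : ℕ} (hs : 0 < s) {lam mu : YoungDiagram} {b : ℤ}
    (h : maya mu = maya lam - single b 1 + single (b - s) 1) : RemovesRimHook s lam mu := by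
  have hdl := diagLen_of_maya_eq h
  -- The hook consists of the last node on each diagonal with content in `(b - s, b]`.
  set H := lam.cells.filter
    (fun x => min x.1 x.2 + 1 = diagLen lam (content x) ∧ b - s < content x ∧ content x ≤ b)
    with hH
  have hmem : ∀ x, x ∈ H ↔ min x.1 x.2 + 1 = diagLen lam (content x) ∧
      b - s < content x ∧ content x ≤ b := by
    intro x
    rw [hH, Finset.mem_filter, YoungDiagram.mem_cells, mem_iff_lt_diagLen]
    omega
  have hex : ∀ d, b - s < d → d ≤ b → ∃ x ∈ H, content x = d := by
    intro d h1 h2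
    have h3 := hdl d
    rw [if_pos ⟨h1, h2⟩] at h3
    have hc : content (diagLen mu d + (-d).toNat, diagLen mu d + d.toNat) = d := by
      simp only [content]; push_cast; omega
    refine ⟨_, (hmem _).2 ?_, hc⟩
    rw [hc]
    simp only
    omega
  have hinj : Set.InjOn content (H : Set (ℕ × ℕ)) := by
    intro x hx y hy hxy
    have h1 := ((hmem x).1 hx).1
    have h2 := ((hmem y).1 hy).1
    rw [hxy] at h1
    exact eq_of_content_eq hxy (by omega)
  have himg : H.image content = Finset.Ioc (b - s) b := by
    ext d
    rw [Finset.mem_image, Finset.mem_Ioc]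
    constructor
    · rintro ⟨x, hx, rfl⟩
      exact ((hmem x).1 hx).2
    · exact fun hd => hex d hd.1 hd.2
  have hadj : ∀ x ∈ H, ∀ y ∈ H, content y = content x + 1 → nodeGraph.Adj x y := by
    intro x hx y hy hxy
    have h1 := ((hmem x).1 hx).1
    have h2 := ((hmem y).1 hy).1
    rw [hxy] at h2
    have h3 : (0 ≤ content x ∧ _) ∨ (content x < 0 ∧ _) :=
      (le_or_gt 0 (content x)).imp (fun h => ⟨h, diagLen_step_of_nonneg lam h⟩)
        (fun h => ⟨h, diagLen_step_of_neg lam h⟩)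
    simp only [nodeGraph]
    generalize diagLen lam (content x + 1) = k at *
    generalize diagLen lam (content x) = l at *
    simp only [content] at *
    omega
  refine ⟨H, ?_, ?_, ?_, ?_⟩
  · intro x hx
    rw [rim, Finset.mem_filter]
    refine ⟨(Finset.mem_filter.1 hx).1, ?_⟩
    have h1 := ((hmem x).1 hx).1
    have h2 : content (x.1 + 1, x.2 + 1) = content x := by simp [content]
    rw [mem_iff_lt_diagLen, h2]
    simp only
    omega
  · rw [← Finset.card_image_of_injOn hinj, himg]
    simp
  · obtain ⟨x₀, hx₀, hc₀⟩ := hex (b - s + 1) (by omega) (by omega)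
    have hreach : ∀ n : ℕ, ∀ x (hx : x ∈ H), content x = b - s + 1 + n →
        (nodeGraph.induce (H : Set (ℕ × ℕ))).Reachable ⟨x₀, hx₀⟩ ⟨x, hx⟩ := by
      intro n
      induction n with
      | zero =>
        intro x hx hxc
        have : x₀ = x := hinj hx₀ hx (by rw [hc₀, hxc]; simp)
        subst this
        exact SimpleGraph.Reachable.refl _
      | succ n ih =>
        intro x hx hxc
        have hxb := ((hmem x).1 hx).2
        push_cast at hxc
        obtain ⟨y, hy, hyc⟩ := hex (b - s + 1 + n) (by omega) (by omega)
        refine (ih y hy hyc).trans (SimpleGraph.Adj.reachable ?_)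
        exact hadj y hy x hx (by omega)
    have hall : ∀ x : (H : Set (ℕ × ℕ)),
        (nodeGraph.induce (H : Set (ℕ × ℕ))).Reachable ⟨x₀, hx₀⟩ x := by
      rintro ⟨x, hx⟩
      have hxb := ((hmem x).1 hx).2
      exact hreach (content x - (b - s + 1)).toNat x hx (by omega)
    have : Nonempty (H : Set (ℕ × ℕ)) := ⟨⟨x₀, hx₀⟩⟩
    exact ⟨fun x y => (hall x).symm.trans (hall y)⟩
  · ext x
    rw [Finset.mem_sdiff, hmem, YoungDiagram.mem_cells, YoungDiagram.mem_cells,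
      mem_iff_lt_diagLen, mem_iff_lt_diagLen]
    have := hdl (content x)
    split_ifs at this <;> omega

theorem isMaya_moveBead {s : ℕ} {e e' : ℤ →₀ ℤ} (he : IsMaya e) (hs : 0 < s)
    (h : MovesBead s e e') : IsMaya e' := by
  obtain ⟨b, h1, h2, rfl⟩ := h
  intro x
  have hx := he x
  simp only [occ] at *
  simp only [Finsupp.add_apply, Finsupp.sub_apply, single_apply]
  split_ifs at * <;> subst_vars <;> omega

theorem isCore_iff {s : ℕ} (hs : 0 < s) (lam : YoungDiagram) :
    IsCore s lam ↔ ∀ b, occ (maya lam) b = 1 → occ (maya lam) (b - s) = 1 := by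
  constructor
  · intro h b hb
    by_contra hb'
    have hm : MovesBead s (maya lam) (maya lam - single b 1 + single (b - s) 1) :=
      ⟨b, hb, (isMaya_maya lam _).resolve_right hb', rfl⟩
    obtain ⟨mu, hmu⟩ := exists_maya_eq (isMaya_moveBead (isMaya_maya lam) hs hm) (by
      simp [linearCombination_maya_one])
    exact h mu (removesRimHook_of_maya_eq hs hmu)
  · intro h mu hmu
    obtain ⟨b, h1, h2, -⟩ := hmu.movesBead hs
    have := h b h1
    omega

/-! ### Cores and residue classes -/

/-- The set of positions holding a bead. -/
def beads (e : ℤ →₀ ℤ) : Set ℤ := {x | occ e x = 1}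

theorem mem_beads {e : ℤ →₀ ℤ} {x : ℤ} : x ∈ beads e ↔ occ e x = 1 := Iff.rfl

theorem exists_beads_bound (e : ℤ →₀ ℤ) :
    ∃ N : ℤ, 0 ≤ N ∧ (∀ x ∈ beads e, x < N) ∧ ∀ x ∉ beads e, -N ≤ x := by
  refine ⟨∑ x ∈ e.support, |x| + 1, by positivity, fun x hx => ?_, fun x hx => ?_⟩
  all_goals
    have hb : e x ≠ 0 → |x| ≤ ∑ x ∈ e.support, |x| := fun hx =>
      Finset.single_le_sum (f := fun x : ℤ => |x|) (fun _ _ => abs_nonneg _)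
        (Finsupp.mem_support_iff.2 hx)
    have hpos : 0 ≤ ∑ x ∈ e.support, |x| := by positivity
    by_contra! hlt
    by_cases h0 : e x = 0
    · rw [mem_beads, occ, h0] at hx
      split_ifs at hx <;> omega
    · have := hb h0
      have := abs_le.1 this
      omega

/-- The sum of `g` over every residue class modulo `s` vanishes. -/
def IsNull (s : ℕ) (g : ℤ →₀ ℤ) : Prop :=
  ∀ φ : ℤ → ℤ, Function.Periodic φ s → linearCombination ℤ φ g = 0

theorem IsNull.zero {s : ℕ} : IsNull s 0 := fun _ _ => map_zero _

theorem IsNull.add {s : ℕ} {g h : ℤ →₀ ℤ} (hg : IsNull s g) (hh : IsNull s h) :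
    IsNull s (g + h) := fun φ hφ => by
  rw [map_add, hg φ hφ, hh φ hφ, add_zero]

theorem IsNull.neg {s : ℕ} {g : ℤ →₀ ℤ} (hg : IsNull s g) : IsNull s (-g) := fun φ hφ => by
  rw [map_neg, hg φ hφ, neg_zero]

theorem periodic_apply_eq {φ : ℤ → ℤ} {s : ℕ} (hφ : Function.Periodic φ s) {x y : ℤ}
    (h : (s : ℤ) ∣ x - y) : φ x = φ y := by
  obtain ⟨k, hk⟩ := h
  have : x = y + k * s := by linarith
  rw [this]
  exact hφ.int_mul k y

theorem isNull_single_sub_single {s : ℕ} {x y : ℤ} (h : (s : ℤ) ∣ x - y) :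
    IsNull s (single x 1 - single y 1) := fun φ hφ => by
  simp [periodic_apply_eq hφ h]

theorem periodic_dvd_sub (s : ℕ) (x : ℤ) :
    Function.Periodic (fun y : ℤ => if (s : ℤ) ∣ y - x then (1 : ℤ) else 0) s := by
  intro y
  have : y + s - x = (y - x) + s := by ring
  simp only [this, dvd_add_self_right]

theorem MovesBead.isNull {s : ℕ} {e e' : ℤ →₀ ℤ} (h : MovesBead s e e') : IsNull s (e - e') := by
  obtain ⟨b, -, -, rfl⟩ := h
  have : e - (e - single b 1 + single (b - s) 1) = single b 1 - single (b - s : ℤ) 1 := by abel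
  rw [this]
  exact isNull_single_sub_single (by simp)

theorem mem_beads_of_le {s : ℕ} {e : ℤ →₀ ℤ} (h : ∀ b ∈ beads e, b - s ∈ beads e) {x y : ℤ}
    (hxy : x ≤ y) (hd : (s : ℤ) ∣ y - x) (hy : y ∈ beads e) : x ∈ beads e := by
  obtain ⟨k, hk⟩ := hd
  rcases Nat.eq_zero_or_pos s with rfl | hs
  · have : x = y := by simp at hk; omega
    exact this ▸ hy
  have hk0 : 0 ≤ k := by
    by_contra! hneg
    have : (s : ℤ) * k < 0 := mul_neg_of_pos_of_neg (by exact_mod_cast hs) hneg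
    omega
  obtain ⟨n, rfl⟩ := Int.eq_ofNat_of_zero_le hk0
  have hall : ∀ n : ℕ, y - s * n ∈ beads e := by
    intro n
    induction n with
    | zero => simpa using hy
    | succ n ih =>
      have := h _ ih
      convert this using 1
      push_cast
      ring
  have := hall n
  rwa [← hk, sub_sub_cancel] at this

/-- Configurations in which no bead can be moved back by `s` are determined by the number of beads
in each residue class. -/
theorem eq_of_isNull_of_closed {s : ℕ} {e e' : ℤ →₀ ℤ} (he : IsMaya e) (he' : IsMaya e')
    (hc : ∀ b ∈ beads e, b - s ∈ beads e) (hc' : ∀ b ∈ beads e', b - s ∈ beads e')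
    (hn : IsNull s (e - e')) : e = e' := by
  have key : ∀ {e e' : ℤ →₀ ℤ}, IsMaya e → IsMaya e' → (∀ b ∈ beads e, b - s ∈ beads e) →
      (∀ b ∈ beads e', b - s ∈ beads e') → IsNull s (e - e') → ∀ x, e x ≤ e' x := by
    intro e e' he he' hc hc' hn x
    by_contra! hlt
    have hx := he x
    have hx' := he' x
    have hxo : occ e x = 1 ∧ occ e' x = 0 := by
      simp only [occ] at hx hx' ⊢
      omega
    -- In the class of `x`, closure fills `e` below `x` and empties `e'` above `x`. So `e - e'` is
    -- nonnegative on this class and positive at `x`, against its zero sum.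
    have h0 := hn _ (periodic_dvd_sub s x)
    rw [linearCombination_apply, Finsupp.sum] at h0
    have hnn : ∀ y ∈ (e - e').support,
        0 ≤ (e - e') y • (if (s : ℤ) ∣ y - x then (1 : ℤ) else 0) := by
      intro y _
      split_ifs with hd
      · rw [smul_eq_mul, mul_one, Finsupp.sub_apply]
        have h1 := he y
        have h2 := he' y
        rcases le_total y x with hyx | hyx
        · have : occ e y = 1 := mem_beads_of_le hc hyx (by rwa [dvd_sub_comm]) hxo.1
          rw [occ] at *
          omega
        · have : ¬ occ e' y = 1 := fun hy => by
            have h3 := mem_beads_of_le hc' hyx hd hy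
            rw [mem_beads] at h3
            omega
          rw [occ] at *
          omega
      · simp
    have := (Finset.sum_eq_zero_iff_of_nonneg hnn).1 h0 x (by
      rw [Finsupp.mem_support_iff, Finsupp.sub_apply]
      omega)
    simp at this
    omega
  ext x
  refine le_antisymm (key he he' hc hc' hn x) (key he' he hc' hc ?_ x)
  rw [← neg_sub]
  exact hn.neg

theorem core_isCore (s : ℕ) (lam : YoungDiagram) : IsCore s (core s lam) :=
  (exists_core_weight s lam).choose_spec.1

theorem removesRimHooks_core (s : ℕ) (lam : YoungDiagram) :
    RemovesRimHooks s (weight s lam) lam (core s lam) :=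
  (exists_core_weight s lam).choose_spec.2

theorem RemovesRimHooks.isNull {s n : ℕ} (hs : 0 < s) {lam mu : YoungDiagram}
    (h : RemovesRimHooks s n lam mu) : IsNull s (maya lam - maya mu) := by
  induction h with
  | refl lam => rw [sub_self]; exact IsNull.zero
  | step h _ ih =>
    have := (h.movesBead hs).isNull.add ih
    rwa [sub_add_sub_cancel] at this

theorem isNull_maya_sub_core {s : ℕ} (hs : 0 < s) (lam : YoungDiagram) :
    IsNull s (maya lam - maya (core s lam)) := (removesRimHooks_core s lam).isNull hs

/-- Bead moves preserve the class counts and these determine a closed configuration; hence the core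
does not depend on the hooks removed. -/
theorem core_eq_of_isCore {s : ℕ} (hs : 0 < s) {lam nu : YoungDiagram} (hnu : IsCore s nu)
    (h : IsNull s (maya lam - maya nu)) : core s lam = nu := by
  refine maya_injective (eq_of_isNull_of_closed (isMaya_maya _) (isMaya_maya _)
    ((isCore_iff hs _).1 (core_isCore s lam)) ((isCore_iff hs _).1 hnu) ?_)
  have := (isNull_maya_sub_core hs lam).neg.add h
  convert this using 1
  abel

theorem core_eq_core_iff {s : ℕ} (hs : 0 < s) {lam mu : YoungDiagram} :
    core s lam = core s mu ↔ IsNull s (maya lam - maya mu) := by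
  constructor
  · intro h
    have := (isNull_maya_sub_core hs lam).add (isNull_maya_sub_core hs mu).neg
    rw [h] at this
    convert this using 1
    abel
  · intro h
    refine core_eq_of_isCore hs (core_isCore s mu) ?_
    have := h.add (isNull_maya_sub_core hs mu)
    rwa [sub_add_sub_cancel] at this

theorem occ_maya_transpose (lam : YoungDiagram) (x : ℤ) :
    occ (maya lam.transpose) x = 1 - occ (maya lam) (-1 - x) := by
  simp only [occ, maya_transpose]
  split_ifs <;> omega

theorem IsCore.transpose {s : ℕ} (hs : 0 < s) {lam : YoungDiagram} (h : IsCore s lam) :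
    IsCore s lam.transpose := by
  rw [isCore_iff hs] at h ⊢
  intro b hb
  rw [occ_maya_transpose] at hb ⊢
  have h1 := isMaya_maya lam (-1 - (b - s))
  have h2 := h (-1 - (b - s))
  rw [show -1 - (b - s) - s = -1 - b by ring] at h2
  omega

theorem linearCombination_maya_transpose (lam : YoungDiagram) (φ : ℤ → ℤ) :
    linearCombination ℤ φ (maya lam.transpose) =
      -linearCombination ℤ (fun x => φ (-1 - x)) (maya lam) := by
  have : maya lam.transpose = -(maya lam).mapDomain (fun x => -1 - x) := by
    ext x
    have hx : x = -1 - (-1 - x) := by ring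
    rw [maya_transpose, Finsupp.neg_apply]
    conv_rhs => rw [hx]
    rw [mapDomain_apply (f := fun x : ℤ => -1 - x) (fun a b h => by simpa using h)]
  rw [this, map_neg, linearCombination_mapDomain]
  rfl

theorem core_transpose {s : ℕ} (hs : 0 < s) (lam : YoungDiagram) :
    core s lam.transpose = (core s lam).transpose := by
  refine core_eq_of_isCore hs ((core_isCore s lam).transpose hs) fun φ hφ => ?_
  rw [map_sub, linearCombination_maya_transpose, linearCombination_maya_transpose,
    ← neg_sub', ← map_sub, neg_eq_zero]
  refine isNull_maya_sub_core hs lam _ fun x => ?_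
  rw [← hφ (-1 - (x + s))]
  congr 1
  ring

/-! ### Weights as numbers of inversions -/

/-- The pairs of a gap and a later bead in the same residue class modulo `s`. -/
def inversions (s : ℕ) (e : ℤ →₀ ℤ) : Set (ℤ × ℤ) :=
  {p | p.1 ∉ beads e ∧ p.2 ∈ beads e ∧ p.1 < p.2 ∧ (s : ℤ) ∣ p.2 - p.1}

theorem inversions_finite (s : ℕ) (e : ℤ →₀ ℤ) : (inversions s e).Finite := by
  obtain ⟨N, -, h1, h2⟩ := exists_beads_bound e
  refine ((Set.finite_Ico (-N) N).prod (Set.finite_Ico (-N) N)).subset ?_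
  rintro ⟨x, y⟩ ⟨hx, hy, hlt, -⟩
  have := h1 y hy
  have := h2 x hx
  simp only [Set.mem_prod, Set.mem_Ico] at *
  omega

theorem MovesBead.ncard_inversions {s : ℕ} (hs : 0 < s) {e e' : ℤ →₀ ℤ}
    (h : MovesBead s e e') : (inversions s e).ncard = (inversions s e').ncard + 1 := by
  obtain ⟨b, hb, hb', rfl⟩ := h
  set e' := e - single b 1 + single (b - s : ℤ) 1 with he'
  have hne : b - s ≠ b := by omega
  -- `σ` carries the beads of `e` to those of `e'`. No position congruent to `b` lies strictly
  -- between `b - s` and `b`, so `σ` keeps the order of every congruent pair except these two, which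
  -- form the lost inversion.
  set σ := Equiv.swap b (b - s) with hσ
  have hσ1 : σ b = b - s := Equiv.swap_apply_left _ _
  have hσ2 : σ (b - s) = b := Equiv.swap_apply_right _ _
  have hσ3 : ∀ x, x ≠ b → x ≠ b - s → σ x = x := fun x => Equiv.swap_apply_of_ne_of_ne
  have hbeads : ∀ x, σ x ∈ beads e' ↔ x ∈ beads e := by
    intro x
    rw [mem_beads, mem_beads, occ, he', Finsupp.add_apply, Finsupp.sub_apply, single_apply,
      single_apply]
    by_cases h1 : x = b
    · subst h1
      rw [hσ1]
      rw [occ] at *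
      simp only [hne.symm, if_false, if_true]
      omega
    · by_cases h2 : x = b - s
      · subst h2
        rw [hσ2]
        rw [occ] at *
        simp only [hne, if_false, if_true]
        omega
      · rw [hσ3 x h1 h2, if_neg (Ne.symm h1), if_neg (Ne.symm h2), occ]
        simp
  have hdvd : ∀ x, (s : ℤ) ∣ σ x - x := by
    intro x
    by_cases h1 : x = b
    · rw [h1, hσ1]; simp
    · by_cases h2 : x = b - s
      · rw [h2, hσ2]; simp
      · rw [hσ3 x h1 h2]; simp
  have hle : ∀ {x y : ℤ}, x < y → (s : ℤ) ∣ y - x → x + s ≤ y := by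
    intro x y hxy hd
    have := Int.le_of_dvd (by omega) hd
    omega
  have hset : inversions s e = insert (b - s, b) ((fun p => (σ p.1, σ p.2)) ⁻¹' inversions s e') := by
    ext ⟨x, y⟩
    simp only [inversions, Set.mem_ofPred_eq, Set.mem_insert_iff, Set.mem_preimage, hbeads,
      Prod.mk.injEq]
    have hd : (s : ℤ) ∣ σ y - σ x ↔ (s : ℤ) ∣ y - x := by
      have h1 : σ y - σ x = (y - x) + ((σ y - y) - (σ x - x)) := by ring
      rw [h1]
      exact dvd_add_left (dvd_sub (hdvd y) (hdvd x))
    rw [hd]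
    have hmain : (s : ℤ) ∣ y - x → ¬ (x = b - s ∧ y = b) → ¬ (x = b ∧ y = b - s) →
        (σ x < σ y ↔ x < y) := by
      intro hd h1 h2
      have a1 : x < b → y = b → x + s ≤ b := fun h h' => hle h (by rwa [h'] at hd)
      have a2 : b < y → x = b → b + s ≤ y := fun h h' => hle h (by rwa [h'] at hd)
      have hd' : (s : ℤ) ∣ x - y := by rwa [dvd_sub_comm]
      have a3 : b < x → y = b → b + s ≤ x := fun h h' => hle h (by rwa [h'] at hd')
      have a4 : y < b → x = b → y + s ≤ b := fun h h' => hle h (by rwa [h'] at hd')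
      have a5 : x < b - s → y = b - s → x + s ≤ b - s := fun h h' => hle h (by rwa [h'] at hd)
      have a6 : b - s < y → x = b - s → b - s + s ≤ y := fun h h' => hle h (by rwa [h'] at hd)
      have a7 : b - s < x → y = b - s → b - s + s ≤ x := fun h h' => hle h (by rwa [h'] at hd')
      have a8 : y < b - s → x = b - s → y + s ≤ b - s := fun h h' => hle h (by rwa [h'] at hd')
      by_cases hx1 : x = b <;> by_cases hx2 : x = b - s <;> by_cases hy1 : y = b <;>
        by_cases hy2 : y = b - s <;> (first | omega | skip) <;>
        (try simp only [hx1, hx2, hy1, hy2, hσ1, hσ2]) <;>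
        (try rw [hσ3 x hx1 hx2]) <;> (try rw [hσ3 y hy1 hy2]) <;> omega
    by_cases c1 : x = b - s ∧ y = b
    · obtain ⟨rfl, rfl⟩ := c1
      simp only [mem_beads, hb, hb', true_and]
      simp
      omega
    · by_cases c2 : x = b ∧ y = b - s
      · obtain ⟨rfl, rfl⟩ := c2
        simp only [mem_beads, hb, hb']
        simp
        omega
      · simp only [c1, false_or]
        constructor
        · rintro ⟨h1, h2, h3, h4⟩
          exact ⟨h1, h2, (hmain h4 c1 c2).2 h3, h4⟩
        · rintro ⟨h1, h2, h3, h4⟩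
          exact ⟨h1, h2, (hmain h4 c1 c2).1 h3, h4⟩
  have hinj : Function.Injective (fun p : ℤ × ℤ => (σ p.1, σ p.2)) := by
    rintro ⟨a, b⟩ ⟨c, d⟩ h
    simpa using h
  have hsurj : Function.Surjective (fun p : ℤ × ℤ => (σ p.1, σ p.2)) := by
    rintro ⟨a, b⟩
    exact ⟨(σ.symm a, σ.symm b), by simp⟩
  rw [hset, Set.ncard_insert_of_notMem _ ((inversions_finite s e').preimage hinj.injOn),
    Set.ncard_preimage_of_injective_subset_range hinj]
  · rw [hsurj.range_eq]; exact Set.subset_univ _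
  · simp only [Set.mem_preimage, hσ1, hσ2, inversions, Set.mem_ofPred_eq]
    omega

theorem inversions_eq_empty {s : ℕ} {e : ℤ →₀ ℤ} (h : ∀ b ∈ beads e, b - s ∈ beads e) :
    inversions s e = ∅ := by
  refine Set.eq_empty_of_forall_notMem ?_
  rintro ⟨x, y⟩ ⟨hx, hy, hlt, hd⟩
  exact hx (mem_beads_of_le h hlt.le hd hy)

theorem RemovesRimHooks.ncard_inversions {s n : ℕ} (hs : 0 < s) {lam mu : YoungDiagram}
    (h : RemovesRimHooks s n lam mu) :
    (inversions s (maya lam)).ncard = (inversions s (maya mu)).ncard + n := by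
  induction h with
  | refl lam => rfl
  | step h _ ih =>
    rw [(h.movesBead hs).ncard_inversions hs, ih]
    ring

theorem weight_eq_ncard_inversions {s : ℕ} (hs : 0 < s) (lam : YoungDiagram) :
    weight s lam = (inversions s (maya lam)).ncard := by
  rw [(removesRimHooks_core s lam).ncard_inversions hs,
    inversions_eq_empty ((isCore_iff hs _).1 (core_isCore s lam)), Set.ncard_empty, zero_add]

/-! ### Comparison of two columns -/

/-- The beads `z` in the residue class of `x` modulo `t` for which the position `z + (y - x)` in the
residue class of `y` is free. -/
def excess (t : ℕ) (e : ℤ →₀ ℤ) (x y : ℤ) : Set ℤ :=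
  {z | (t : ℤ) ∣ z - x ∧ z ∈ beads e ∧ z + (y - x) ∉ beads e}

theorem excess_finite (t : ℕ) (e : ℤ →₀ ℤ) (x y : ℤ) : (excess t e x y).Finite := by
  obtain ⟨N, -, h1, h2⟩ := exists_beads_bound e
  refine (Set.finite_Ico (-N - (y - x)) N).subset ?_
  rintro z ⟨-, hz, hz'⟩
  have := h1 _ hz
  have := h2 _ hz'
  rw [Set.mem_Ico]
  omega

theorem excess_congr {t : ℕ} {e : ℤ →₀ ℤ} {x y x' y' : ℤ} (h : (t : ℤ) ∣ x - x')
    (h' : y - x = y' - x') : excess t e x y = excess t e x' y' := by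
  ext z
  have : (t : ℤ) ∣ z - x ↔ (t : ℤ) ∣ z - x' := by
    rw [show z - x' = (z - x) + (x - x') by ring]
    exact (dvd_add_left h).symm
  simp only [excess, Set.mem_ofPred_eq, h', this]

/-- The positions `z` in the residue class of `x` that are free while `z + (y - x)` is not. -/
theorem ncard_excess_symm (t : ℕ) (e : ℤ →₀ ℤ) (x y : ℤ) :
    (excess t e y x).ncard =
      {z | (t : ℤ) ∣ z - x ∧ z ∉ beads e ∧ z + (y - x) ∈ beads e}.ncard := by
  conv_rhs => rw [← Set.ncard_image_of_injective _ (add_left_injective (y - x))]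
  congr 1
  ext z
  simp only [excess, Set.mem_ofPred_eq, Set.mem_image]
  constructor
  · rintro ⟨h1, h2, h3⟩
    refine ⟨z - (y - x), ⟨?_, ?_, ?_⟩, by ring⟩
    · convert h1 using 1; ring
    · convert h3 using 2; ring
    · convert h2 using 1; ring
  · rintro ⟨w, ⟨h1, h2, h3⟩, rfl⟩
    refine ⟨?_, h3, ?_⟩
    · convert h1 using 1; ring
    · convert h2 using 2; ring

theorem ncard_eq_sum_indicator {A : Set ℤ} [DecidablePred (· ∈ A)] {I : Finset ℤ}
    (h : A ⊆ I) : (A.ncard : ℤ) = ∑ z ∈ I, if z ∈ A then 1 else 0 := by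
  have : A = ((I.filter (· ∈ A) : Finset ℤ) : Set ℤ) := by
    ext z
    simp only [Finset.coe_filter, Set.mem_ofPred_eq]
    exact ⟨fun hz => ⟨h hz, hz⟩, fun hz => hz.2⟩
  conv_lhs => rw [this, Set.ncard_coe_finset, Finset.card_filter]
  push_cast
  rfl

/-- The difference of the two excesses depends only on the numbers of beads in the residue
classes. -/
theorem ncard_excess_sub_eq {t : ℕ} {e e' : ℤ →₀ ℤ} (he : IsMaya e) (he' : IsMaya e')
    (hn : IsNull t (e - e')) (x y : ℤ) :
    ((excess t e x y).ncard : ℤ) - (excess t e y x).ncard =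
      (excess t e' x y).ncard - (excess t e' y x).ncard := by
  classical
  set h := y - x with hh
  obtain ⟨N, -, h1, h2⟩ := exists_beads_bound e
  obtain ⟨N', -, h1', h2'⟩ := exists_beads_bound e'
  set M := |N| + |N'| + |h| with hM
  have hN := abs_le.1 (le_refl |N|)
  have hN' := abs_le.1 (le_refl |N'|)
  have hhb := abs_le.1 (le_refl |h|)
  have habs := abs_nonneg N
  have habs' := abs_nonneg N'
  set I := Finset.Ico (-M) M with hI
  have key : ∀ f : ℤ →₀ ℤ, IsMaya f → ∀ K : ℤ, |K| ≤ |N| + |N'| → (∀ x ∈ beads f, x < K) →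
      (∀ x ∉ beads f, -K ≤ x) → ((excess t f x y).ncard : ℤ) - (excess t f y x).ncard =
        ∑ z ∈ I, if (t : ℤ) ∣ z - x then occ f z - occ f (z + h) else 0 := by
    intro f hf K hK k1 k2
    have hKb := abs_le.1 (le_refl |K|)
    rw [ncard_excess_symm t f x y, ncard_eq_sum_indicator (A := excess t f x y) (I := I),
      ncard_eq_sum_indicator (I := I), ← Finset.sum_sub_distrib]
    · refine Finset.sum_congr rfl fun z _ => ?_
      simp only [excess, Set.mem_ofPred_eq, ← hh, mem_beads]
      have a1 := hf z
      have a2 := hf (z + h)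
      by_cases hd : (t : ℤ) ∣ z - x <;> simp only [hd, true_and, false_and, if_true, if_false]
      · split_ifs <;> omega
      · simp
    · rintro z ⟨-, hz1, hz2⟩
      have := k2 _ hz1
      have := k1 _ hz2
      simp only [hI, Finset.coe_Ico, Set.mem_Ico]
      omega
    · rintro z ⟨-, hz1, hz2⟩
      have := k1 _ hz1
      have := k2 _ hz2
      simp only [hI, Finset.coe_Ico, Set.mem_Ico]
      omega
  rw [key e he N (by omega) h1 h2, key e' he' N' (by omega) h1' h2', ← sub_eq_zero,
    ← Finset.sum_sub_distrib]
  set g := e - e' with hg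
  have hgs : ∀ z, g z ≠ 0 → -(|N| + |N'|) ≤ z ∧ z < |N| + |N'| := by
    intro z hz
    rw [hg, Finsupp.sub_apply] at hz
    have b1 := he z
    have b2 := he' z
    by_cases c1 : z ∈ beads e <;> by_cases c2 : z ∈ beads e'
    · simp only [mem_beads, occ] at c1 c2
      omega
    · have := h1 _ c1
      have := h2' _ c2
      omega
    · have := h2 _ c1
      have := h1' _ c2
      omega
    · simp only [mem_beads, occ] at c1 c2 b1 b2
      omega
  -- The sum of the translate over the class of `x` is the sum of `g` over the class of `y`; both
  -- class sums of `g` vanish.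
  set g' := g - g.mapDomain (fun z => z - h) with hg'
  have hg'z : ∀ z, g' z = g z - g (z + h) := by
    intro z
    rw [hg', Finsupp.sub_apply]
    congr 1
    conv_lhs => rw [show z = (z + h) - h by ring]
    rw [mapDomain_apply (f := fun z : ℤ => z - h) (fun a b h => by simpa using h)]
  have hnull : linearCombination ℤ (fun z : ℤ => if (t : ℤ) ∣ z - x then (1 : ℤ) else 0) g' = 0 := by
    rw [hg', map_sub, linearCombination_mapDomain, hn _ (periodic_dvd_sub t x), zero_sub,
      neg_eq_zero]
    convert hn _ (periodic_dvd_sub t y) using 2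
    congr 1
    funext z
    simp only [Function.comp_apply]
    rw [show z - h - x = z - y by rw [hh]; ring]
  rw [linearCombination_apply, Finsupp.sum_of_support_subset (s := I)] at hnull
  · rw [← hnull]
    refine Finset.sum_congr rfl fun z _ => ?_
    rw [hg'z, hg, Finsupp.sub_apply, Finsupp.sub_apply]
    simp only [occ, smul_eq_mul]
    split_ifs <;> ring
  · intro z hz
    rw [Finsupp.mem_support_iff, hg'z] at hz
    have c1 := hgs z
    have c2 := hgs (z + h)
    rw [hI, Finset.mem_Ico]
    by_cases h0 : g z = 0
    · have := c2 (by omega)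
      omega
    · have := c1 h0
      omega
  · simp

/-- `e₀` has no bead that can be moved back by `t`, and has as many beads as `e` in every
residue class. -/
structure IsMayaCore (t : ℕ) (e₀ e : ℤ →₀ ℤ) : Prop where
  left : IsMaya e₀
  right : IsMaya e
  closed : ∀ b ∈ beads e₀, b - t ∈ beads e₀
  isNull : IsNull t (e - e₀)

theorem isMayaCore_maya_core {t : ℕ} (ht : 0 < t) (lam : YoungDiagram) :
    IsMayaCore t (maya (core t lam)) (maya lam) :=
  ⟨isMaya_maya _, isMaya_maya _, (isCore_iff ht _).1 (core_isCore t lam),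
    isNull_maya_sub_core ht lam⟩

/-- In a closed configuration every class is filled up to a threshold, so two columns are nested
after any shift. -/
theorem excess_eq_empty_or {t : ℕ} {e₀ : ℤ →₀ ℤ} (hc : ∀ b ∈ beads e₀, b - t ∈ beads e₀)
    (x y : ℤ) : excess t e₀ x y = ∅ ∨ excess t e₀ y x = ∅ := by
  by_contra! h
  obtain ⟨⟨z, hz1, hz2, hz3⟩, ⟨w, hw1, hw2, hw3⟩⟩ := h
  have h1 : z < w + (x - y) := by
    by_contra! hle
    refine hw3 (mem_beads_of_le hc hle ?_ hz2)
    rw [show z - (w + (x - y)) = (z - x) - (w - y) by ring]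
    exact dvd_sub hz1 hw1
  have h2 : w < z + (y - x) := by
    by_contra! hle
    refine hz3 (mem_beads_of_le hc hle ?_ hw2)
    rw [show w - (z + (y - x)) = (w - y) - (z - x) by ring]
    exact dvd_sub hw1 hz1
  omega

/-- Both configurations have the same difference of excesses, and one excess of `e₀` is zero. What
`e` has beyond `e₀` is thus its smaller excess. -/
theorem IsMayaCore.ncard_excess_eq {t : ℕ} {e₀ e : ℤ →₀ ℤ} (h : IsMayaCore t e₀ e) (x y : ℤ) :
    (excess t e x y).ncard = (excess t e₀ x y).ncard +
      min (excess t e x y).ncard (excess t e y x).ncard := by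
  have h1 := ncard_excess_sub_eq h.right h.left h.isNull x y
  rcases excess_eq_empty_or h.closed x y with h2 | h2 <;>
    · replace h2 := congrArg Set.ncard h2
      rw [Set.ncard_empty] at h2
      omega

/-- The columns of `x` and `y` are not nested. -/
def Crossed (t : ℕ) (e : ℤ →₀ ℤ) (x y : ℤ) : Prop :=
  (excess t e x y).Nonempty ∧ (excess t e y x).Nonempty

theorem Crossed.symm {t : ℕ} {e : ℤ →₀ ℤ} {x y : ℤ} (h : Crossed t e x y) : Crossed t e y x :=
  ⟨h.2, h.1⟩

theorem crossed_iff {t : ℕ} {e : ℤ →₀ ℤ} {x y : ℤ} :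
    Crossed t e x y ↔ min (excess t e x y).ncard (excess t e y x).ncard ≠ 0 := by
  have h1 := Set.ncard_pos (excess_finite t e x y)
  have h2 := Set.ncard_pos (excess_finite t e y x)
  rw [Crossed, ← h1, ← h2]
  omega

theorem crossed_congr {t : ℕ} {e : ℤ →₀ ℤ} {x y x' y' : ℤ} (h : (t : ℤ) ∣ x - x')
    (h' : y - x = y' - x') : Crossed t e x y ↔ Crossed t e x' y' := by
  rw [Crossed, Crossed, excess_congr h h', excess_congr (x := y) (x' := y') _ (by linarith)]
  rwa [show y - y' = x - x' by linarith]

/-! ### Weight differences as sums over pairs of columns -/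

/-- Differences and residues that index the pairs of columns. -/
noncomputable def columnPairs (s t : ℕ) (K : ℤ) : Finset (ℤ × ℤ) :=
  ((Finset.Icc 1 K).filter (fun h => (s : ℤ) ∣ h)) ×ˢ Finset.Ico 0 (t : ℤ)

theorem ncard_inversions_eq_sum {s t : ℕ} (ht : 0 < t) {e : ℤ →₀ ℤ} {N K : ℤ}
    (h1 : ∀ x ∈ beads e, x < N) (h2 : ∀ x ∉ beads e, -N ≤ x) (hK : 2 * N ≤ K) :
    (inversions s e).ncard = ∑ p ∈ columnPairs s t K, (excess t e (p.2 + p.1) p.2).ncard := by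
  -- Inversions are sorted by their difference and the residue of the gap modulo `t`; within a fibre
  -- the bead determines the pair.
  rw [Set.ncard_eq_toFinset_card _ (inversions_finite s e),
    Finset.card_eq_sum_card_fiberwise (f := fun p : ℤ × ℤ => (p.2 - p.1, p.1 % (t : ℤ))) (t := columnPairs s t K)]
  · refine Finset.sum_congr rfl ?_
    rintro ⟨h, r⟩ hp
    simp only [columnPairs, Finset.mem_product, Finset.mem_filter, Finset.mem_Icc,
      Finset.mem_Ico] at hp
    rw [Set.ncard_eq_toFinset_card _ (excess_finite t e _ _)]
    refine Finset.card_bij (fun p _ => p.2) ?_ ?_ ?_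
    · rintro ⟨x, y⟩ hxy
      simp only [Finset.mem_filter, Set.Finite.mem_toFinset, inversions, Set.mem_ofPred_eq,
        Prod.mk.injEq] at hxy
      simp only [Set.Finite.mem_toFinset, excess, Set.mem_ofPred_eq]
      obtain ⟨⟨a1, a2, a3, a4⟩, rfl, rfl⟩ := hxy
      refine ⟨?_, a2, ?_⟩
      · rw [show y - (x % t + (y - x)) = x - x % t by ring]
        exact Int.dvd_self_sub_emod
      · convert a1 using 2; ring
    · rintro ⟨x, y⟩ hxy ⟨x', y'⟩ hxy' heq
      simp only [Finset.mem_filter, Prod.mk.injEq] at hxy hxy' heq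
      ext <;> simp <;> omega
    · intro z hz
      simp only [Set.Finite.mem_toFinset, excess, Set.mem_ofPred_eq] at hz
      obtain ⟨a1, a2, a3⟩ := hz
      refine ⟨(z - h, z), ?_, rfl⟩
      simp only [Finset.mem_filter, Set.Finite.mem_toFinset, inversions, Set.mem_ofPred_eq,
        Prod.mk.injEq]
      refine ⟨⟨?_, a2, by omega, ?_⟩, by ring, ?_⟩
      · convert a3 using 2; ring
      · convert hp.1.2 using 1; ring
      · have : z - h ≡ r [ZMOD t] := by
          refine (Int.modEq_iff_dvd.2 ?_).symm
          convert a1 using 1; ring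
        rw [show (z - h) % t = r % t from this, Int.emod_eq_of_lt hp.2.1 hp.2.2]
  · rintro ⟨x, y⟩ hxy
    rw [Finset.mem_coe, Set.Finite.mem_toFinset] at hxy
    obtain ⟨a1, a2, a3, a4⟩ := hxy
    have b1 := h1 _ a2
    have b2 := h2 _ a1
    have : (t : ℤ) ≠ 0 := by omega
    simp only [columnPairs, Finset.coe_product, Set.mem_prod, Finset.mem_coe, Finset.mem_filter,
      Finset.mem_Icc, Finset.mem_Ico]
    refine ⟨⟨by simp only at *; omega, a4⟩, Int.emod_nonneg _ this, Int.emod_lt_of_pos _ (by omega)⟩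

theorem finset_sum_eq_one_iff {ι : Type*} {I : Finset ι} {f : ι → ℕ} :
    ∑ i ∈ I, f i = 1 ↔ ∃ i ∈ I, f i = 1 ∧ ∀ j ∈ I, j ≠ i → f j = 0 := by
  classical
  constructor
  · intro h
    obtain ⟨i, hi, hne⟩ := Finset.exists_ne_zero_of_sum_ne_zero (h ▸ one_ne_zero)
    have h1 := Finset.add_sum_erase I f hi
    have h2 : ∑ j ∈ I.erase i, f j = 0 := by omega
    exact ⟨i, hi, by omega, fun j hj hji =>
      Finset.sum_eq_zero_iff.1 h2 j (Finset.mem_erase.2 ⟨hji, hj⟩)⟩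
  · rintro ⟨i, hi, h1, h0⟩
    rw [Finset.sum_eq_single_of_mem i hi h0, h1]

/-- The excesses of `e₀` cancel, which leaves the sum of the smaller excesses of `e`; it is one iff
one term is one and the others vanish. The column `x` matters only modulo `t`. -/
theorem ncard_inversions_sub_eq_one_iff {s t : ℕ} (ht : 0 < t) {e₀ e : ℤ →₀ ℤ}
    (hc : IsMayaCore t e₀ e) :
    ((inversions s e).ncard : ℤ) - (inversions s e₀).ncard = 1 ↔
      ∃ x h : ℤ, 0 < h ∧ (s : ℤ) ∣ h ∧
        min (excess t e x (x + h)).ncard (excess t e (x + h) x).ncard = 1 ∧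
        ∀ x' h' : ℤ, 0 < h' → (s : ℤ) ∣ h' → Crossed t e x' (x' + h') →
          h' = h ∧ (t : ℤ) ∣ x' - x := by
  obtain ⟨N, hN0, h1, h2⟩ := exists_beads_bound e
  obtain ⟨N', hN0', h1', h2'⟩ := exists_beads_bound e₀
  -- Large enough for one index set to serve both configurations.
  set K := 2 * N + 2 * N' with hK
  rw [ncard_inversions_eq_sum ht (K := K) h1 h2 (by omega),
    ncard_inversions_eq_sum ht (K := K) h1' h2' (by omega)]
  have hsum : ((∑ p ∈ columnPairs s t K, (excess t e (p.2 + p.1) p.2).ncard : ℕ) : ℤ) -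
      (∑ p ∈ columnPairs s t K, (excess t e₀ (p.2 + p.1) p.2).ncard : ℕ) =
      (∑ p ∈ columnPairs s t K,
        min (excess t e (p.2 + p.1) p.2).ncard (excess t e p.2 (p.2 + p.1)).ncard : ℕ) := by
    rw [sub_eq_iff_eq_add, ← Nat.cast_add, ← Finset.sum_add_distrib]
    congr 1
    refine Finset.sum_congr rfl fun p _ => ?_
    rw [add_comm (min _ _), ← hc.ncard_excess_eq]
  have hmem : ∀ x h : ℤ, 0 < h → (s : ℤ) ∣ h → Crossed t e x (x + h) →
      (h, x % t) ∈ columnPairs s t K := by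
    rintro x h hh hd ⟨-, z, -, hz1, hz2⟩
    have := h1 _ hz1
    have := h2 _ hz2
    have : (t : ℤ) ≠ 0 := by omega
    simp only [columnPairs, Finset.mem_product, Finset.mem_filter, Finset.mem_Icc, Finset.mem_Ico]
    exact ⟨⟨by omega, hd⟩, Int.emod_nonneg _ this, Int.emod_lt_of_pos _ (by omega)⟩
  have hmod : ∀ x h : ℤ, Crossed t e x (x + h) ↔ Crossed t e (x % t) (x % t + h) := fun x h =>
    crossed_congr Int.dvd_self_sub_emod (by ring)
  rw [hsum, Nat.cast_eq_one, finset_sum_eq_one_iff]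
  constructor
  · rintro ⟨⟨h, r⟩, hp, hone, hzero⟩
    have hp' := hp
    simp only [columnPairs, Finset.mem_product, Finset.mem_filter, Finset.mem_Icc,
      Finset.mem_Ico] at hp'
    refine ⟨r, h, by omega, hp'.1.2, by rw [min_comm]; exact hone, fun x' h' hh' hd' hcr => ?_⟩
    by_contra hne
    have hz := hzero (h', x' % t) (hmem x' h' hh' hd' hcr) (fun heq => hne ?_)
    · rw [hmod, crossed_iff, min_comm] at hcr
      exact hcr hz
    · obtain ⟨rfl, rfl⟩ := Prod.mk.inj heq
      exact ⟨rfl, Int.dvd_self_sub_emod⟩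
  · rintro ⟨x, h, hh, hd, hone, huniq⟩
    have hcr : Crossed t e x (x + h) := by rw [crossed_iff]; omega
    refine ⟨(h, x % t), hmem x h hh hd hcr, ?_, ?_⟩
    · simp only
      rw [min_comm, ← excess_congr (x := x) (y := x + h) Int.dvd_self_sub_emod (by ring),
        ← excess_congr (x := x + h) (y := x) (x' := x % t + h) _ (by ring)]
      · exact hone
      · convert Int.dvd_self_sub_emod (x := x) (m := t) using 1; ring
    · rintro ⟨h', r⟩ hp hne
      by_contra hne'
      rw [min_comm, ← ne_eq, ← crossed_iff] at hne'
      simp only [columnPairs, Finset.mem_product, Finset.mem_filter, Finset.mem_Icc,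
        Finset.mem_Ico] at hp
      obtain ⟨rfl, hdr⟩ := huniq r h' (by omega) hp.1.2 hne'
      apply hne
      have : x ≡ r [ZMOD t] := Int.modEq_iff_dvd.2 hdr
      rw [show x % t = r % t from this, Int.emod_eq_of_lt hp.2.1 hp.2.2]

/-! ### Column heights -/

/-- The first free position in the residue class of `x` modulo `t`. -/
noncomputable def gapPos (t : ℕ) (e₀ : ℤ →₀ ℤ) (x : ℤ) : ℤ :=
  sInf {z : ℤ | (t : ℤ) ∣ z - x ∧ z ∉ beads e₀}

theorem gapPos_periodic (t : ℕ) (e₀ : ℤ →₀ ℤ) : Function.Periodic (gapPos t e₀) t := by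
  intro x
  simp only [gapPos]
  congr 1
  ext z
  have : z - (x + t) = (z - x) - t := by ring
  simp only [Set.mem_ofPred_eq, this, dvd_sub_self_right]

theorem exists_large_dvd_sub {s : ℕ} (hs : 0 < s) (x N : ℤ) : ∃ z, N ≤ z ∧ (s : ℤ) ∣ z - x := by
  refine ⟨x + s * (|N| + |x|), ?_, by simp⟩
  have h1 := neg_abs_le x
  have h2 := le_abs_self N
  have h3 : 1 * (|N| + |x|) ≤ s * (|N| + |x|) :=
    mul_le_mul_of_nonneg_right (by omega) (by positivity)
  omega

theorem exists_small_dvd_sub {s : ℕ} (hs : 0 < s) (x N : ℤ) : ∃ z, z < N ∧ (s : ℤ) ∣ z - x := by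
  obtain ⟨z, h1, h2⟩ := exists_large_dvd_sub hs (-x) (-N + 1)
  obtain ⟨k, hk⟩ := h2
  exact ⟨-z, by omega, -k, by linear_combination -hk⟩

theorem gapPos_mem {t : ℕ} (ht : 0 < t) (e₀ : ℤ →₀ ℤ) (x : ℤ) :
    (t : ℤ) ∣ gapPos t e₀ x - x ∧ gapPos t e₀ x ∉ beads e₀ := by
  obtain ⟨N, -, h1, h2⟩ := exists_beads_bound e₀
  obtain ⟨z, hz, hd⟩ := exists_large_dvd_sub ht x N
  exact Int.csInf_mem (s := {z : ℤ | (t : ℤ) ∣ z - x ∧ z ∉ beads e₀})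
    ⟨z, hd, fun h => by have := h1 z h; omega⟩ ⟨-N, fun w hw => h2 w hw.2⟩

theorem mem_beads_iff_lt_gapPos {t : ℕ} (ht : 0 < t) {e₀ : ℤ →₀ ℤ}
    (hc : ∀ b ∈ beads e₀, b - t ∈ beads e₀) {x z : ℤ} (hz : (t : ℤ) ∣ z - x) :
    z ∈ beads e₀ ↔ z < gapPos t e₀ x := by
  obtain ⟨hd, hn⟩ := gapPos_mem ht e₀ x
  constructor
  · intro h
    by_contra! hle
    refine hn (mem_beads_of_le hc hle ?_ h)
    rw [show z - gapPos t e₀ x = (z - x) - (gapPos t e₀ x - x) by ring]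
    exact dvd_sub hz hd
  · intro h
    by_contra hz'
    obtain ⟨N, -, -, h2⟩ := exists_beads_bound e₀
    exact notMem_of_lt_csInf h ⟨-N, fun w hw => h2 w hw.2⟩ ⟨hz, hz'⟩

/-- The position, relative to `x`, of the first free position in the residue class of `x`.
For `x` and `y` this compares the number of beads in the columns of `x` and `y`. -/
noncomputable def colHeight (t : ℕ) (e₀ : ℤ →₀ ℤ) (x : ℤ) : ℤ := gapPos t e₀ x - x

/-- The class and its first gap stay put while the origin moves. Heights can thus be shifted by
multiples of `s * t` without leaving the row. -/
theorem colHeight_add_mul (t : ℕ) (e₀ : ℤ →₀ ℤ) (x m : ℤ) :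
    colHeight t e₀ (x + m * t) = colHeight t e₀ x - m * t := by
  have := (gapPos_periodic t e₀).int_mul m x
  rw [Int.cast_id] at this
  rw [colHeight, colHeight, this]
  ring

theorem excess_eq_empty_of_le {t : ℕ} (ht : 0 < t) {e₀ : ℤ →₀ ℤ}
    (hc : ∀ b ∈ beads e₀, b - t ∈ beads e₀) {x y : ℤ}
    (h : colHeight t e₀ x ≤ colHeight t e₀ y) : excess t e₀ x y = ∅ := by
  refine Set.eq_empty_of_forall_notMem ?_
  rintro z ⟨h1, h2, h3⟩
  rw [mem_beads_iff_lt_gapPos ht hc h1] at h2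
  rw [mem_beads_iff_lt_gapPos ht hc (x := y) (by convert h1 using 1; ring)] at h3
  simp only [colHeight] at h
  omega

theorem excess_nonempty_of_lt {t : ℕ} (ht : 0 < t) {e₀ : ℤ →₀ ℤ}
    (hc : ∀ b ∈ beads e₀, b - t ∈ beads e₀) {x y : ℤ}
    (h : colHeight t e₀ x < colHeight t e₀ y) : (excess t e₀ y x).Nonempty := by
  have hx := (gapPos_mem ht e₀ x).1
  have hy := (gapPos_mem ht e₀ y).1
  have hle : (t : ℤ) ≤ colHeight t e₀ y - colHeight t e₀ x :=
    Int.le_of_dvd (by omega) (dvd_sub hy hx)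
  have hz : (t : ℤ) ∣ gapPos t e₀ y - t - y := by
    rw [show gapPos t e₀ y - t - y = (gapPos t e₀ y - y) - t by ring]
    exact dvd_sub hy dvd_rfl
  simp only [colHeight] at hle
  refine ⟨gapPos t e₀ y - t, hz, ?_, ?_⟩
  · rw [mem_beads_iff_lt_gapPos ht hc hz]
    omega
  · rw [mem_beads_iff_lt_gapPos ht hc (x := x) (by convert hz using 1; ring)]
    omega

section

variable {s t : ℕ} {e₀ e : ℤ →₀ ℤ}

/-- Heights decide which excess is empty in the core, and the difference of excesses carries this
over to `e`. -/
theorem IsMayaCore.ncard_excess_le (ht : 0 < t) (hc : IsMayaCore t e₀ e) {x y : ℤ}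
    (h : colHeight t e₀ x ≤ colHeight t e₀ y) :
    (excess t e x y).ncard ≤ (excess t e y x).ncard := by
  have := hc.ncard_excess_eq x y
  rw [excess_eq_empty_of_le ht hc.closed h, Set.ncard_empty] at this
  omega

theorem IsMayaCore.ncard_excess_lt (ht : 0 < t) (hc : IsMayaCore t e₀ e) {x y : ℤ}
    (h : colHeight t e₀ x < colHeight t e₀ y) :
    (excess t e x y).ncard < (excess t e y x).ncard := by
  have h1 := hc.ncard_excess_eq y x
  have h2 := hc.ncard_excess_le ht h.le
  have h3 := (Set.ncard_pos (excess_finite t e₀ y x)).2 (excess_nonempty_of_lt ht hc.closed h)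
  omega

theorem IsMayaCore.excess_eq_empty (ht : 0 < t) (hc : IsMayaCore t e₀ e) {x y : ℤ}
    (h : colHeight t e₀ x ≤ colHeight t e₀ y) (hn : ¬ Crossed t e x y) :
    excess t e x y = ∅ := by
  have := hc.ncard_excess_le ht h
  rw [crossed_iff, not_not] at hn
  rw [← Set.ncard_eq_zero (excess_finite t e x y)]
  omega

theorem IsMayaCore.colHeight_eq (ht : 0 < t) (hc : IsMayaCore t e₀ e) {x y : ℤ}
    (h : (excess t e x y).ncard = (excess t e y x).ncard) :
    colHeight t e₀ x = colHeight t e₀ y := by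
  rcases lt_trichotomy (colHeight t e₀ x) (colHeight t e₀ y) with h1 | h1 | h1
  · have := hc.ncard_excess_lt ht h1
    omega
  · exact h1
  · have := hc.ncard_excess_lt ht h1
    omega

/-! ### The rearrangement argument -/

/-- If beads always sit in columns at least as high as those of the gaps of the same row, then
another configuration with the same row and column sums can differ only where there is a tie. -/
theorem exists_colHeight_eq {e' : ℤ →₀ ℤ} (hs : 0 < s) (he : IsMaya e)
    (he' : IsMaya e') (hns : IsNull s (e' - e)) (hnt : IsNull t (e' - e))
    (hid : linearCombination ℤ (fun x : ℤ => x) (e' - e) = 0)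
    (hup : ∀ x ∈ beads e, ∀ y ∉ beads e, (s : ℤ) ∣ y - x → colHeight t e₀ y ≤ colHeight t e₀ x)
    {x : ℤ} (hx : e' x ≠ e x) :
    ∃ y, (s : ℤ) ∣ y - x ∧ colHeight t e₀ x = colHeight t e₀ y ∧
      (x ∈ beads e ∧ y ∉ beads e ∨ x ∉ beads e ∧ y ∈ beads e) := by
  obtain ⟨N, -, hN1, hN2⟩ := exists_beads_bound e
  set A : ℤ → Set ℤ := fun x => colHeight t e₀ '' {y | y ∉ beads e ∧ (s : ℤ) ∣ y - x} with hA
  -- The greatest height of a gap in the row of `x`: gaps lie at or below this threshold, beads at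
  -- or above it.
  set θ : ℤ → ℤ := fun x => sSup (A x) with hθ
  have hne : ∀ x, (A x).Nonempty := by
    intro x
    obtain ⟨z, hz, hd⟩ := exists_large_dvd_sub hs x N
    exact ⟨_, z, ⟨fun h => by have := hN1 z h; omega, hd⟩, rfl⟩
  have hdd : ∀ {x y z : ℤ}, (s : ℤ) ∣ y - x → (s : ℤ) ∣ z - x → (s : ℤ) ∣ y - z := by
    intro x y z h1 h2
    rw [show y - z = (y - x) - (z - x) by ring]
    exact dvd_sub h1 h2
  have hbd : ∀ x, BddAbove (A x) := by
    intro x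
    obtain ⟨z, hz, hd⟩ := exists_small_dvd_sub hs x (-N)
    refine ⟨colHeight t e₀ z, ?_⟩
    rintro _ ⟨y, ⟨hy, hyd⟩, rfl⟩
    refine hup z ?_ y hy (hdd hyd hd)
    by_contra h
    have := hN2 z h
    omega
  have hgap : ∀ y ∉ beads e, colHeight t e₀ y ≤ θ y := fun y hy =>
    le_csSup (hbd y) ⟨y, ⟨hy, by simp⟩, rfl⟩
  have hbead : ∀ y ∈ beads e, θ y ≤ colHeight t e₀ y := by
    intro y hy
    refine csSup_le (hne y) ?_
    rintro _ ⟨z, ⟨hz, hzd⟩, rfl⟩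
    exact hup y hy z hz hzd
  have hper : Function.Periodic θ s := by
    intro x
    simp only [hθ, hA]
    congr 2
    ext z
    have : z - (x + s) = (z - x) - s := by ring
    simp only [Set.mem_ofPred_eq, this, dvd_sub_self_right]
  set g := e' - e with hg
  have hsgn : ∀ y, (y ∈ beads e → g y = 0 ∨ g y = -1) ∧ (y ∉ beads e → g y = 0 ∨ g y = 1) := by
    intro y
    have h1 := he y
    have h2 := he' y
    rw [hg, Finsupp.sub_apply, mem_beads]
    simp only [occ] at *
    omega
  -- The function is `θ`, of period `s`, minus `gapPos`, of period `t`, plus the identity, so `g` is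
  -- orthogonal to it. All terms are nonnegative, hence zero.
  have hsum : linearCombination ℤ (fun y => θ y - colHeight t e₀ y) g = 0 := by
    simp only [colHeight]
    rw [linearCombination_sub_fun, linearCombination_sub_fun, hns θ hper,
      hnt _ (gapPos_periodic t e₀), hid]
    rfl
  have hnn : ∀ y, 0 ≤ g y • (θ y - colHeight t e₀ y) := by
    intro y
    rw [smul_eq_mul]
    by_cases hy : y ∈ beads e
    · have h1 := hbead y hy
      rcases (hsgn y).1 hy with h2 | h2 <;> rw [h2] <;> omega
    · have h1 := hgap y hy
      rcases (hsgn y).2 hy with h2 | h2 <;> rw [h2] <;> omega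
  rw [linearCombination_apply, Finsupp.sum] at hsum
  have htie : ∀ y, g y ≠ 0 → θ y = colHeight t e₀ y := by
    intro y hy
    have := (Finset.sum_eq_zero_iff_of_nonneg fun y _ => hnn y).1 hsum y
      (Finsupp.mem_support_iff.2 hy)
    rcases smul_eq_zero.1 this with h | h
    · exact absurd h hy
    · omega
  have hgx : g x ≠ 0 := by
    rw [hg, Finsupp.sub_apply]
    omega
  by_cases hxb : x ∈ beads e
  · obtain ⟨y, ⟨hy, hyd⟩, hyθ⟩ := Int.csSup_mem (hne x) (hbd x)
    exact ⟨y, hyd, by rw [← htie x hgx, hyθ], Or.inl ⟨hxb, hy⟩⟩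
  -- The gap `x` gains a bead, so some bead `y` of its row is lost; both lie at the threshold `θ`.
  · have h0 := hns _ (periodic_dvd_sub s x)
    have : ∃ y ∈ g.support, g y • (if (s : ℤ) ∣ y - x then (1 : ℤ) else 0) < 0 := by
      by_contra! hcon
      rw [linearCombination_apply, Finsupp.sum, Finset.sum_eq_zero_iff_of_nonneg hcon] at h0
      have := h0 x (Finsupp.mem_support_iff.2 hgx)
      simp [hgx] at this
    obtain ⟨y, hys, hy⟩ := this
    have hyd : (s : ℤ) ∣ y - x := by
      by_contra h
      simp [h] at hy
    rw [if_pos hyd, smul_eq_mul, mul_one] at hy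
    refine ⟨y, hyd, ?_, Or.inr ⟨hxb, ?_⟩⟩
    · rw [← htie x hgx, ← htie y (by omega)]
      exact (periodic_apply_eq hper hyd).symm
    · by_contra hyb
      have := (hsgn y).2 hyb
      omega

theorem IsMayaCore.exists_crossed {e' : ℤ →₀ ℤ} (hs : 0 < s) (ht : 0 < t)
    (hc : IsMayaCore t e₀ e) (he' : IsMaya e') (hns : IsNull s (e' - e)) (hnt : IsNull t (e' - e))
    (hid : linearCombination ℤ (fun x : ℤ => x) (e' - e) = 0)
    (heq : ∀ x y, (s : ℤ) ∣ y - x → Crossed t e x y →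
      (excess t e x y).ncard = (excess t e y x).ncard)
    {x : ℤ} (hx : e' x ≠ e x) :
    ∃ y, (s : ℤ) ∣ y - x ∧ Crossed t e x y ∧ (x ∈ excess t e x y ∨ y ∈ excess t e y x) := by
  -- A bead facing a gap of a strictly higher column would make the two columns cross with unequal
  -- excesses.
  have hup : ∀ x ∈ beads e, ∀ y ∉ beads e, (s : ℤ) ∣ y - x →
      colHeight t e₀ y ≤ colHeight t e₀ x := by
    intro x hx y hy hd
    by_contra! hlt
    have h1 := hc.ncard_excess_lt ht hlt
    have h2 := (Set.ncard_pos (excess_finite t e x y)).2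
      ⟨x, by simp, hx, by rw [add_sub_cancel]; exact hy⟩
    have := heq x y hd (crossed_iff.2 (by omega))
    omega
  obtain ⟨y, hyd, hxy, h⟩ := exists_colHeight_eq (e₀ := e₀) hs hc.right he' hns hnt hid hup hx
  have hcard := le_antisymm (hc.ncard_excess_le ht hxy.le) (hc.ncard_excess_le ht hxy.ge)
  have hmem : x ∈ excess t e x y ∨ y ∈ excess t e y x := by
    refine h.imp (fun h => ⟨by simp, h.1, ?_⟩) (fun h => ⟨by simp, h.2, ?_⟩)
    · rw [add_sub_cancel]; exact h.2
    · rw [add_sub_cancel]; exact h.1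
  refine ⟨y, hyd, ?_, hmem⟩
  rw [Crossed, ← Set.ncard_pos (excess_finite t e x y), ← Set.ncard_pos (excess_finite t e y x),
    ← hcard, and_self, Set.ncard_pos (excess_finite t e x y)]
  rcases hmem with h | h
  · exact ⟨x, h⟩
  · rw [← Set.ncard_pos (excess_finite t e x y), hcard, Set.ncard_pos (excess_finite t e y x)]
    exact ⟨y, h⟩

/-! ### Shifts of a column by `s * t` -/

/-- If the column of `x` is nested with all columns outside the residue class of `x`, then it
contains its own shifts. -/
theorem IsMayaCore.mem_beads_of_add_mem (hs : 0 < s) (ht : 1 < t)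
    (hc : IsMayaCore t e₀ e) {x : ℤ} (h : ∀ k : ℤ, ¬ (t : ℤ) ∣ k → ¬ Crossed t e x (x + k * s))
    {z : ℤ} (hz : (t : ℤ) ∣ z - x) (hb : z + s * t ∈ beads e) : z ∈ beads e := by
  have hst : (0 : ℤ) < s * t := by positivity
  set c := colHeight t e₀ x - colHeight t e₀ (x + s) with hcd
  -- The columns of `x + (1 + m * t) * s` and `x + (1 + m * t - t) * s` have heights `s * t` apart,
  -- and this `m` puts the height of `x` between them. Nestedness then carries the bead `z + s * t`
  -- to `z + (1 + m * t) * s` and on to `z`.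
  set m := -(c / (s * t)) with hm
  have hk : ¬ (t : ℤ) ∣ 1 + m * t := by
    rw [dvd_add_left (Dvd.intro_left m rfl)]
    intro h1
    have := Int.le_of_dvd one_pos h1
    omega
  have hk' : ¬ (t : ℤ) ∣ 1 + m * t - t := by
    rwa [dvd_sub_self_right]
  have h1 : colHeight t e₀ (x + (1 + m * t) * s) = colHeight t e₀ (x + s) - m * s * t := by
    rw [← colHeight_add_mul]
    congr 1
    ring
  have h2 : colHeight t e₀ (x + (1 + m * t - t) * s) =
      colHeight t e₀ (x + s) - m * s * t + s * t := by
    rw [show x + (1 + m * t - t) * s = (x + s) + (m * s - s) * t by ring, colHeight_add_mul]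
    ring
  have hmod := Int.emod_nonneg c hst.ne'
  have hmod' := Int.emod_lt_of_pos c hst
  have hdm := Int.emod_add_mul_ediv c (s * t)
  have hms : m * s * t = -(s * t * (c / (s * t))) := by rw [hm]; ring
  have e1 := hc.excess_eq_empty (by omega) (x := x + (1 + m * t) * s) (y := x)
    (by omega) (fun hcr => h _ hk hcr.symm)
  have e2 := hc.excess_eq_empty (by omega) (x := x) (y := x + (1 + m * t - t) * s)
    (by omega) (h _ hk')
  have hzb : z + (1 + m * t) * s ∈ beads e := by
    by_contra hcon
    have : z + s * t ∈ excess t e x (x + (1 + m * t - t) * s) := by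
      refine ⟨?_, hb, ?_⟩
      · rw [show z + s * t - x = (z - x) + s * t by ring]
        exact dvd_add hz (Dvd.intro_left _ rfl)
      · convert hcon using 2; ring
    rw [e2] at this
    exact this
  by_contra hcon
  have : z + (1 + m * t) * s ∈ excess t e (x + (1 + m * t) * s) x := by
    refine ⟨?_, hzb, ?_⟩
    · convert hz using 1; ring
    · convert hcon using 2; ring
  rw [e1] at this
  exact this

/-- A variant of `IsMayaCore.mem_beads_of_add_mem` in which the column of `x` is allowed to cross
one other column. -/
theorem IsMayaCore.mem_beads_of_add_mem_of_singleton (hs : 0 < s) (ht : 0 < t)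
    (hc : IsMayaCore t e₀ e) {x k₀ p q : ℤ} (hk₀ : ¬ (t : ℤ) ∣ k₀)
    (hp : excess t e x (x + k₀ * s) = {p}) (hq : excess t e (x + k₀ * s) x = {q})
    (hpq : ¬ (s : ℤ) ∣ p - q)
    (h : ∀ k : ℤ, ¬ (t : ℤ) ∣ k → k ≠ k₀ → ¬ Crossed t e x (x + k * s))
    {z : ℤ} (hz : (t : ℤ) ∣ z - x) (hb : z + s * t ∈ beads e) : z ∈ beads e := by
  have hst : (0 : ℤ) < s * t := by positivity
  -- Since the heights at `x` and `x + k₀ * s` agree, the columns for `k₀ + t` and `k₀ - t` lie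
  -- strictly below and above that of `x`.
  have hht : colHeight t e₀ x = colHeight t e₀ (x + k₀ * s) :=
    hc.colHeight_eq ht (by rw [hp, hq, Set.ncard_singleton, Set.ncard_singleton])
  have h1 : colHeight t e₀ (x + (k₀ + t) * s) = colHeight t e₀ (x + k₀ * s) - s * t := by
    rw [← colHeight_add_mul]
    congr 1
    ring
  have h2 : colHeight t e₀ (x + (k₀ - t) * s) = colHeight t e₀ (x + k₀ * s) + s * t := by
    rw [show x + (k₀ - t) * s = (x + k₀ * s) + (-s) * t by ring, colHeight_add_mul]
    ring
  have e1 := hc.excess_eq_empty ht (x := x + (k₀ + t) * s) (y := x)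
    (by omega) (fun hcr => h _ (by rwa [dvd_add_self_right]) (by omega) hcr.symm)
  have e2 := hc.excess_eq_empty ht (x := x) (y := x + (k₀ - t) * s)
    (by omega) (h _ (by rwa [dvd_sub_self_right]) (by omega))
  by_contra hzn
  have hzs : (t : ℤ) ∣ z + s * t - x := by
    rw [show z + s * t - x = (z - x) + s * t by ring]
    exact dvd_add hz (Dvd.intro_left _ rfl)
  have hzb : z + k₀ * s ∈ beads e := by
    by_contra hcon
    have : z + s * t ∈ excess t e x (x + (k₀ - t) * s) := by
      refine ⟨hzs, hb, ?_⟩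
      convert hcon using 2; ring
    rw [e2] at this
    exact this
  have hzq : z + k₀ * s ∈ excess t e (x + k₀ * s) x := by
    refine ⟨?_, hzb, ?_⟩
    · convert hz using 1; ring
    · convert hzn using 2; ring
  have hzg : z + s * t + k₀ * s ∉ beads e := by
    intro hcon
    have : z + s * t + k₀ * s ∈ excess t e (x + (k₀ + t) * s) x := by
      refine ⟨?_, hcon, ?_⟩
      · convert hz using 1; ring
      · convert hzn using 2; ring
    rw [e1] at this
    exact this
  have hzp : z + s * t ∈ excess t e x (x + k₀ * s) := by
    refine ⟨hzs, hb, ?_⟩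
    convert hzg using 2; ring
  -- The two positions must be `q` and `p`, but they differ by `s * (t - k₀)`.
  rw [hq, Set.mem_singleton_iff] at hzq
  rw [hp, Set.mem_singleton_iff] at hzp
  apply hpq
  rw [← hzq, ← hzp, show z + s * t - (z + k₀ * s) = s * (t - k₀) by ring]
  exact Dvd.intro _ rfl

/-- By coprimality `h` is a multiple of `s * t`, and a column closed under subtracting `s * t` is
nested with its own translates by such `h`. -/
theorem not_crossed_of_add_mem (hst : Nat.Coprime s t) {x h : ℤ}
    (hcl : ∀ z : ℤ, (t : ℤ) ∣ z - x → z + s * t ∈ beads e → z ∈ beads e)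
    (hs : (s : ℤ) ∣ h) (ht : (t : ℤ) ∣ h) : ¬ Crossed t e x (x + h) := by
  have hall : ∀ n : ℕ, ∀ z : ℤ, (t : ℤ) ∣ z - x → z + n * (s * t) ∈ beads e → z ∈ beads e := by
    intro n
    induction n with
    | zero => intro z _ h; simpa using h
    | succ n ih =>
      intro z hz h
      refine ih z hz (hcl _ ?_ ?_)
      · rw [show z + n * (s * t) - x = (z - x) + n * s * t by ring]
        exact dvd_add hz (Dvd.intro_left _ rfl)
      · convert h using 1; push_cast; ring
  obtain ⟨m, hm⟩ := (Nat.isCoprime_iff_coprime.2 hst).mul_dvd hs ht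
  rintro ⟨⟨z, hz1, hz2, hz3⟩, ⟨w, hw1, hw2, hw3⟩⟩
  have hthx : ∀ {v : ℤ}, (t : ℤ) ∣ v - x → (t : ℤ) ∣ v + h - x := by
    intro v hv
    rw [show v + h - x = (v - x) + h by ring]
    exact dvd_add hv ht
  rcases le_total 0 m with h0 | h0
  · obtain ⟨n, rfl⟩ := Int.eq_ofNat_of_zero_le h0
    refine hw3 (hall n _ ?_ ?_)
    · convert hw1 using 1; ring
    · convert hw2 using 1; linear_combination -hm
  · obtain ⟨n, hn⟩ := Int.eq_ofNat_of_zero_le (neg_nonneg.2 h0)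
    refine hz3 (hall n _ ?_ ?_)
    · convert hthx hz1 using 1; ring
    · convert hz2 using 1
      have : m = -n := by omega
      rw [this] at hm
      linear_combination hm

/-- Without such a crossing the column would be closed under subtracting `s * t`, which also rules
out crossings with `t ∣ h`. -/
theorem IsMayaCore.exists_crossed_not_dvd (hs : 0 < s) (ht : 1 < t) (hst : Nat.Coprime s t)
    (hc : IsMayaCore t e₀ e) {x h : ℤ} (hsh : (s : ℤ) ∣ h) (hcr : Crossed t e x (x + h)) :
    ∃ k : ℤ, ¬ (t : ℤ) ∣ k ∧ Crossed t e x (x + k * s) := by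
  by_contra! hcon
  by_cases hth : (t : ℤ) ∣ h
  · exact not_crossed_of_add_mem hst (fun z => hc.mem_beads_of_add_mem hs ht hcon) hsh hth hcr
  · obtain ⟨k, rfl⟩ := hsh
    refine hcon k (fun hk => hth (hk.mul_left _)) ?_
    rwa [mul_comm]

end

/-! ### Quads and exchanges -/

/-- `mu` has the same size, the same `s`-core and the same `t`-core as `lam`. -/
def SameCores (s t : ℕ) (lam mu : YoungDiagram) : Prop :=
  mu.card = lam.card ∧ core s mu = core s lam ∧ core t mu = core t lam

theorem SameCores.symm_st {s t : ℕ} {lam mu : YoungDiagram} (h : SameCores s t lam mu) :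
    SameCores t s lam mu := ⟨h.1, h.2.2, h.2.1⟩

theorem sameCores_iff {s t : ℕ} (hs : 0 < s) (ht : 0 < t) {lam mu : YoungDiagram} :
    SameCores s t lam mu ↔ linearCombination ℤ (fun x : ℤ => x) (maya mu - maya lam) = 0 ∧
      IsNull s (maya mu - maya lam) ∧ IsNull t (maya mu - maya lam) := by
  rw [SameCores, core_eq_core_iff hs, core_eq_core_iff ht, map_sub, linearCombination_maya_id,
    linearCombination_maya_id, sub_eq_zero, Nat.cast_inj]

/-- The configuration obtained by moving the beads at `a` and `b` to `c` and `d`. -/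
noncomputable def exchange (e : ℤ →₀ ℤ) (a b c d : ℤ) : ℤ →₀ ℤ :=
  e - single a 1 - single b 1 + single c 1 + single d 1

theorem exchange_apply (e : ℤ →₀ ℤ) (a b c d x : ℤ) :
    exchange e a b c d x = e x - (if a = x then 1 else 0) - (if b = x then 1 else 0) +
      (if c = x then 1 else 0) + (if d = x then 1 else 0) := by
  simp only [exchange, Finsupp.add_apply, Finsupp.sub_apply, single_apply]

/-- Two beads `a`, `b` and two gaps `c`, `d` that form a parallelogram with sides that are
multiples of `s` and of `t`. -/
structure IsQuad (s t : ℕ) (e : ℤ →₀ ℤ) (a b c d : ℤ) : Prop where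
  bead₁ : a ∈ beads e
  bead₂ : b ∈ beads e
  gap₁ : c ∉ beads e
  gap₂ : d ∉ beads e
  ne_bead : a ≠ b
  ne_gap : c ≠ d
  add_eq : a + b = c + d
  dvd_s : (s : ℤ) ∣ c - a
  dvd_t : (t : ℤ) ∣ d - a

section

variable {s t : ℕ} {a b c d : ℤ}

theorem IsQuad.symm_st {e : ℤ →₀ ℤ} (h : IsQuad s t e a b c d) : IsQuad t s e a b d c :=
  ⟨h.bead₁, h.bead₂, h.gap₂, h.gap₁, h.ne_bead, h.ne_gap.symm, by rw [h.add_eq, add_comm],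
    h.dvd_t, h.dvd_s⟩

/-- Pairing `a` with `c` and `b` with `d` preserves the class counts modulo `s`; pairing `a` with
`d` and `b` with `c` preserves those modulo `t`. The size is kept by `a + b = c + d`. -/
theorem IsQuad.exists_eq_exchange (hs : 0 < s) (ht : 0 < t) {lam : YoungDiagram}
    (h : IsQuad s t (maya lam) a b c d) :
    ∃ mu, maya mu = exchange (maya lam) a b c d ∧ mu ≠ lam ∧ SameCores s t lam mu := by
  obtain ⟨h1, h2, h3, h4, hab, hcd, hadd, hds, hdt⟩ := h
  have hM : IsMaya (exchange (maya lam) a b c d) := by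
    intro x
    have hx := isMaya_maya lam x
    simp only [mem_beads] at h1 h2 h3 h4
    rw [occ, exchange_apply]
    rw [occ] at hx
    have e1 : a = x → occ (maya lam) x = 1 := fun h => h ▸ h1
    have e2 : b = x → occ (maya lam) x = 1 := fun h => h ▸ h2
    have e3 : c = x → ¬ occ (maya lam) x = 1 := fun h => h ▸ h3
    have e4 : d = x → ¬ occ (maya lam) x = 1 := fun h => h ▸ h4
    rw [occ] at e1 e2 e3 e4
    split_ifs at * <;> omega
  obtain ⟨mu, hmu⟩ := exists_maya_eq hM (by simp [exchange, linearCombination_maya_one])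
  have hsub : maya mu - maya lam = (single c 1 - single a 1) + (single d 1 - single b 1) := by
    rw [hmu, exchange]
    abel
  have hsub' : maya mu - maya lam = (single d 1 - single a 1) + (single c 1 - single b 1) := by
    rw [hsub]
    abel
  refine ⟨mu, hmu, ?_, (sameCores_iff hs ht).2 ⟨?_, ?_, ?_⟩⟩
  · rintro rfl
    have := DFunLike.congr_fun hmu a
    rw [exchange_apply, if_pos rfl, if_neg hab.symm, if_neg (fun hca : c = a => h3 (hca ▸ h1)),
      if_neg (fun hda : d = a => h4 (hda ▸ h1))] at this
    omega
  · rw [hsub]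
    simp only [map_add, map_sub, linearCombination_single, one_smul]
    omega
  · rw [hsub]
    refine (isNull_single_sub_single hds).add (isNull_single_sub_single ?_)
    rw [show d - b = -(c - a) by omega]
    exact hds.neg_right
  · rw [hsub']
    refine (isNull_single_sub_single hdt).add (isNull_single_sub_single ?_)
    rw [show c - b = -(d - a) by omega]
    exact hdt.neg_right

/-- The beads and the gaps of a quad can be recovered from the result of the exchange. -/
theorem IsQuad.mem_of_exchange_eq {e : ℤ →₀ ℤ} {a' b' c' d' : ℤ} (h : IsQuad s t e a b c d)
    (heq : exchange e a b c d = exchange e a' b' c' d') :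
    (a = a' ∨ a = b') ∧ (b = a' ∨ b = b') ∧ (c = c' ∨ c = d') ∧ (d = c' ∨ d = d') := by
  obtain ⟨h1, h2, h3, h4, hab, hcd, -⟩ := h
  have key := fun x => DFunLike.congr_fun heq x
  simp only [exchange_apply] at key
  have hac : a ≠ c := fun h => h3 (h ▸ h1)
  have had : a ≠ d := fun h => h4 (h ▸ h1)
  have hbc : b ≠ c := fun h => h3 (h ▸ h2)
  have hbd : b ≠ d := fun h => h4 (h ▸ h2)
  refine ⟨?_, ?_, ?_, ?_⟩ <;> by_contra! hn
  · have := key a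
    rw [if_pos rfl, if_neg hab.symm, if_neg hac.symm, if_neg had.symm, if_neg hn.1.symm,
      if_neg hn.2.symm] at this
    split_ifs at this <;> omega
  · have := key b
    rw [if_neg hab, if_pos rfl, if_neg hbc.symm, if_neg hbd.symm, if_neg hn.1.symm,
      if_neg hn.2.symm] at this
    split_ifs at this <;> omega
  · have := key c
    rw [if_neg hac, if_neg hbc, if_pos rfl, if_neg hcd.symm, if_neg hn.1.symm,
      if_neg hn.2.symm] at this
    split_ifs at this <;> omega
  · have := key d
    rw [if_neg had, if_neg hbd, if_neg hcd, if_pos rfl, if_neg hn.1.symm,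
      if_neg hn.2.symm] at this
    split_ifs at this <;> omega

/-- The condition `t ∤ h` keeps the two beads, and the two gaps, distinct. -/
theorem isQuad_of_mem_excess {e : ℤ →₀ ℤ} {x h p q : ℤ} (hs : (s : ℤ) ∣ h) (ht : ¬ (t : ℤ) ∣ h)
    (hp : p ∈ excess t e x (x + h)) (hq : q ∈ excess t e (x + h) x) :
    IsQuad s t e p q (p + h) (q - h) := by
  obtain ⟨p1, p2, p3⟩ := hp
  obtain ⟨q1, q2, q3⟩ := hq
  have hd : (t : ℤ) ∣ q - h - p := by
    rw [show q - h - p = (q - (x + h)) - (p - x) by ring]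
    exact dvd_sub q1 p1
  refine ⟨p2, q2, ?_, ?_, ?_, ?_, by ring, by simpa using hs, hd⟩
  · convert p3 using 2; ring
  · convert q3 using 2; ring
  · rintro rfl
    apply ht
    have := hd.neg_right
    rwa [show -(p - h - p) = h by ring] at this
  · intro heq
    apply ht
    rwa [show q - h - p = h by omega] at hd

theorem not_dvd_mul_of_coprime (hst : Nat.Coprime s t) {k : ℤ} (hk : ¬ (t : ℤ) ∣ k) :
    ¬ (t : ℤ) ∣ k * s := fun h =>
  hk ((Nat.isCoprime_iff_coprime.2 hst.symm).dvd_of_dvd_mul_right h)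

/-- A bead `p` and a gap `q - h` of one column that are gap and bead in another column give
crossing rows. -/
theorem crossed_rows {e : ℤ →₀ ℤ} {x h p q : ℤ} (hs : (s : ℤ) ∣ h)
    (hp : p ∈ excess t e x (x + h)) (hq : q ∈ excess t e (x + h) x) :
    Crossed s e p (p + (q - h - p)) := by
  obtain ⟨p1, p2, p3⟩ := hp
  obtain ⟨q1, q2, q3⟩ := hq
  refine ⟨⟨p, by simp, p2, ?_⟩, ⟨q, ?_, q2, ?_⟩⟩
  · convert q3 using 2; ring
  · convert hs using 1; ring
  · convert p3 using 2; ring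

theorem dvd_of_mem_excess {e : ℤ →₀ ℤ} {x h p q : ℤ}
    (hp : p ∈ excess t e x (x + h)) (hq : q ∈ excess t e (x + h) x) : (t : ℤ) ∣ q - h - p := by
  rw [show q - h - p = (q - (x + h)) - (p - x) by ring]
  exact dvd_sub hq.1 hp.1

/-! ### From uniqueness to weights -/

/-- If exactly one other partition has the same size and cores as `lam`, then the `s`-weight
of `lam` exceeds that of its `t`-core by one. -/
theorem weight_sub_weight_core_eq_one (hs : 1 < s) (ht : 1 < t) (hst : Nat.Coprime s t)
    {lam mu₀ : YoungDiagram} (hne : mu₀ ≠ lam) (hsame : SameCores s t lam mu₀)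
    (huniq : ∀ mu, SameCores s t lam mu → mu = lam ∨ mu = mu₀) :
    (weight s lam : ℤ) - weight s (core t lam) = 1 := by
  have hs0 : 0 < s := by omega
  have ht0 : 0 < t := by omega
  have hct := isMayaCore_maya_core ht0 lam
  have hcs := isMayaCore_maya_core hs0 lam
  set e := maya lam with he
  have hquad : ∀ a b c d, IsQuad s t e a b c d → exchange e a b c d = maya mu₀ := by
    intro a b c d hq
    obtain ⟨mu, hmu, hmune, hmus⟩ := hq.exists_eq_exchange hs0 ht0
    rw [← hmu, (huniq mu hmus).resolve_left hmune]
  obtain ⟨hid, hns, hnt⟩ := (sameCores_iff hs0 ht0).1 hsame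
  -- a crossing of columns from different residue classes
  obtain ⟨x, k₀, hk₀pos, hk₀, hcr⟩ : ∃ x k : ℤ, 0 < k ∧ ¬ (t : ℤ) ∣ k ∧
      Crossed t e x (x + k * s) := by
    obtain ⟨x, hx⟩ : ∃ x, maya mu₀ x ≠ e x := by
      by_contra! hcon
      exact hne (maya_injective (Finsupp.ext hcon))
    obtain ⟨x, h, hsh, hcr⟩ : ∃ x h : ℤ, (s : ℤ) ∣ h ∧ Crossed t e x (x + h) := by
      by_contra! hcon
      have hcon' : ∀ x y, (s : ℤ) ∣ y - x → ¬ Crossed t e x y := fun x y hd hcr =>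
        hcon x (y - x) hd (by rwa [add_sub_cancel])
      obtain ⟨y, hd, hcr, -⟩ := hct.exists_crossed hs0 ht0 (isMaya_maya mu₀) hns hnt hid
        (fun x y hd hcr => absurd hcr (hcon' x y hd)) hx
      exact hcon' x y hd hcr
    obtain ⟨k, hk, hcr'⟩ := hct.exists_crossed_not_dvd hs0 ht hst hsh hcr
    rcases lt_trichotomy k 0 with h0 | rfl | h0
    · refine ⟨x + k * s, -k, by omega, by rwa [dvd_neg], ?_⟩
      rw [show x + k * s + -k * s = x by ring]
      exact hcr'.symm
    · exact absurd (dvd_zero _) hk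
    · exact ⟨x, k, h0, hk, hcr'⟩
  set h₀ := k₀ * s with hh₀
  have hsh₀ : (s : ℤ) ∣ h₀ := Dvd.intro_left _ rfl
  have hth₀ : ¬ (t : ℤ) ∣ h₀ := not_dvd_mul_of_coprime hst hk₀
  obtain ⟨⟨p, hp⟩, ⟨q, hq⟩⟩ := hcr
  have hq₀ := isQuad_of_mem_excess hsh₀ hth₀ hp hq
  -- All exchanges produce `mu₀`, so all quads have the same beads and the same gaps.
  have hrec : ∀ a b c d, IsQuad s t e a b c d → (a = p ∨ a = q) ∧ (b = p ∨ b = q) ∧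
      (c = p + h₀ ∨ c = q - h₀) ∧ (d = p + h₀ ∨ d = q - h₀) := fun a b c d hq =>
    hq.mem_of_exchange_eq ((hquad _ _ _ _ hq).trans (hquad _ _ _ _ hq₀).symm)
  have hpx : (t : ℤ) ∣ p - x := hp.1
  have hqx : (t : ℤ) ∣ q - (x + h₀) := hq.1
  have hdiff : ∀ {u v w : ℤ}, (t : ℤ) ∣ u → (t : ℤ) ∣ v → u - v = w → (t : ℤ) ∣ w :=
    fun hu hv h => h ▸ dvd_sub hu hv
  have huc : ∀ x' h' : ℤ, (s : ℤ) ∣ h' → ¬ (t : ℤ) ∣ h' → Crossed t e x' (x' + h') →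
      (h' = h₀ ∧ (t : ℤ) ∣ x' - x) ∨ (h' = -h₀ ∧ (t : ℤ) ∣ x' - (x + h₀)) := by
    rintro x' h' hs' ht' ⟨⟨p', hp'⟩, ⟨q', hq'⟩⟩
    have hQ := isQuad_of_mem_excess hs' ht' hp' hq'
    obtain ⟨r1, -, r3, -⟩ := hrec _ _ _ _ hQ
    have hp'x : (t : ℤ) ∣ p' - x' := hp'.1
    rcases r1 with rfl | rfl
    · rcases r3 with r3 | r3
      · exact Or.inl ⟨by omega, hdiff hpx hp'x (by ring)⟩
      · exfalso
        have := dvd_of_mem_excess hp hq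
        rw [show q - h₀ - p' = h' by omega] at this
        exact ht' this
    · rcases r3 with r3 | r3
      · exfalso
        have := (dvd_of_mem_excess hp hq).neg_right
        rw [show -(p' - h₀ - p) = h' by omega] at this
        exact ht' this
      · exact Or.inr ⟨by omega, hdiff hqx hp'x (by ring)⟩
  have hTp : excess t e x (x + h₀) = {p} := by
    refine Set.eq_singleton_iff_unique_mem.2 ⟨hp, fun p' hp' => ?_⟩
    have hQ := isQuad_of_mem_excess hsh₀ hth₀ hp' hq
    exact (hrec _ _ _ _ hQ).1.resolve_right hQ.ne_bead
  have hTq : excess t e (x + h₀) x = {q} := by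
    refine Set.eq_singleton_iff_unique_mem.2 ⟨hq, fun q' hq' => ?_⟩
    have hQ := isQuad_of_mem_excess hsh₀ hth₀ hp hq'
    exact (hrec _ _ _ _ hQ).2.1.resolve_left hQ.ne_bead.symm
  -- Otherwise all four corners are congruent modulo `s`. The rows through `p` and `q - h₀` cross,
  -- so there is also a crossing of incongruent rows; its quad has the same corners, a
  -- contradiction.
  have hspq : ¬ (s : ℤ) ∣ p - q := by
    intro hd
    have hd' : (s : ℤ) ∣ q - h₀ - p := by
      rw [show q - h₀ - p = -(p - q) - h₀ by ring]
      exact dvd_sub hd.neg_right hsh₀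
    obtain ⟨k, hk, ⟨p', hp'⟩, ⟨q', hq'⟩⟩ := hcs.exists_crossed_not_dvd ht0 hs hst.symm
      (dvd_of_mem_excess hp hq) (crossed_rows hsh₀ hp hq)
    have hkt := not_dvd_mul_of_coprime hst.symm hk
    have hQ := (isQuad_of_mem_excess (Dvd.intro_left _ rfl) hkt hp' hq').symm_st
    obtain ⟨r1, -, -, r4⟩ := hrec _ _ _ _ hQ
    apply hkt
    obtain ⟨u, hu⟩ := hd
    rcases r1 with r1 | r1 <;> rcases r4 with r4 | r4
    · exact ⟨k₀, by linear_combination r4 - r1⟩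
    · exact ⟨-u - k₀, by linear_combination r4 - r1 - hu⟩
    · exact ⟨u + k₀, by linear_combination r4 - r1 + hu⟩
    · exact ⟨-k₀, by linear_combination r4 - r1⟩
  have hclx : ∀ z : ℤ, (t : ℤ) ∣ z - x → z + s * t ∈ beads e → z ∈ beads e := by
    refine fun z => hct.mem_beads_of_add_mem_of_singleton hs0 ht0 hk₀ hTp hTq hspq ?_
    intro k hk hkk hcr
    rcases huc x (k * s) (Dvd.intro_left _ rfl) (not_dvd_mul_of_coprime hst hk) hcr with h | h
    · exact hkk (mul_right_cancel₀ (by omega) h.1)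
    · apply hth₀
      simpa using h.2
  have hcly : ∀ z : ℤ, (t : ℤ) ∣ z - (x + h₀) → z + s * t ∈ beads e → z ∈ beads e := by
    have hxx : x + h₀ + -k₀ * s = x := by rw [hh₀]; ring
    refine fun z => hct.mem_beads_of_add_mem_of_singleton hs0 ht0 (k₀ := -k₀) (p := q) (q := p)
      (by rwa [dvd_neg]) (by rw [hxx, hTq]) (by rw [hxx, hTp]) (by rwa [dvd_sub_comm]) ?_
    intro k hk hkk hcr
    rcases huc _ (k * s) (Dvd.intro_left _ rfl) (not_dvd_mul_of_coprime hst hk) hcr with h | h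
    · apply hth₀
      simpa using h.2
    · refine hkk (mul_right_cancel₀ (b := (s : ℤ)) (by omega) ?_)
      rw [h.1, hh₀]
      ring
  -- Such a crossing entails one with `t ∤ k` in the same column, which is then that of `x` or of `x
  -- + h₀`; both are closed under subtracting `s * t`.
  have hnc : ∀ x' h' : ℤ, (s : ℤ) ∣ h' → Crossed t e x' (x' + h') → ¬ (t : ℤ) ∣ h' := by
    intro x' h' hs' hcr ht'
    obtain ⟨k, hk, hcr'⟩ := hct.exists_crossed_not_dvd hs0 ht hst hs' hcr
    rcases huc _ _ (Dvd.intro_left _ rfl) (not_dvd_mul_of_coprime hst hk) hcr' with h | h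
    · exact not_crossed_of_add_mem hst hclx hs' ht' ((crossed_congr h.2 (by ring)).1 hcr)
    · exact not_crossed_of_add_mem hst hcly hs' ht' ((crossed_congr h.2 (by ring)).1 hcr)
  have hh₀pos : 0 < h₀ := mul_pos hk₀pos (by omega)
  rw [weight_eq_ncard_inversions hs0, weight_eq_ncard_inversions hs0,
    ncard_inversions_sub_eq_one_iff ht0 hct]
  refine ⟨x, h₀, hh₀pos, hsh₀, ?_, fun x' h' hh' hs' hcr => ?_⟩
  · rw [hTp, hTq]
    simp
  · rcases huc x' h' hs' (hnc x' h' hs' hcr) hcr with h | h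
    · exact h
    · omega

/-! ### From weights to uniqueness -/

theorem IsMayaCore.not_dvd_of_unique {e₀ e : ℤ →₀ ℤ} (hs : 0 < s) (ht : 1 < t)
    (hst : Nat.Coprime s t) (hc : IsMayaCore t e₀ e) {x h : ℤ} (hsh : (s : ℤ) ∣ h)
    (hcr : Crossed t e x (x + h))
    (huniq : ∀ x' h' : ℤ, 0 < h' → (s : ℤ) ∣ h' → Crossed t e x' (x' + h') →
      h' = h ∧ (t : ℤ) ∣ x' - x) : ¬ (t : ℤ) ∣ h := by
  intro hth
  obtain ⟨k, hk, hcr'⟩ := hc.exists_crossed_not_dvd hs ht hst hsh hcr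
  have hkt := not_dvd_mul_of_coprime hst hk
  rcases lt_trichotomy k 0 with h0 | rfl | h0
  · have := huniq (x + k * s) (-k * s) (mul_pos (by omega) (by omega)) (Dvd.intro_left _ rfl) (by
      rw [show x + k * s + -k * s = x by ring]
      exact hcr'.symm)
    apply hkt
    rw [← dvd_neg, ← neg_mul, this.1]
    exact hth
  · exact hk (dvd_zero _)
  · have := huniq x (k * s) (mul_pos h0 (by omega)) (Dvd.intro_left _ rfl) hcr'
    exact hkt (this.1 ▸ hth)

/-- If both weight differences are one, then there is a quad outside of which all partitions
with the same size and cores agree. -/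
theorem exists_quad_of_weight_sub_eq_one (hs : 1 < s) (ht : 1 < t) (hst : Nat.Coprime s t)
    {lam : YoungDiagram} (hws : (weight s lam : ℤ) - weight s (core t lam) = 1)
    (hwt : (weight t lam : ℤ) - weight t (core s lam) = 1) :
    ∃ a b c d : ℤ, IsQuad s t (maya lam) a b c d ∧ ¬ (t : ℤ) ∣ c - a ∧ ¬ (s : ℤ) ∣ d - a ∧
      ∀ mu, SameCores s t lam mu → ∀ x, maya mu x ≠ maya lam x →
        x = a ∨ x = b ∨ x = c ∨ x = d := by
  have hs0 : 0 < s := by omega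
  have ht0 : 0 < t := by omega
  have hct := isMayaCore_maya_core ht0 lam
  have hcs := isMayaCore_maya_core hs0 lam
  rw [weight_eq_ncard_inversions hs0, weight_eq_ncard_inversions hs0,
    ncard_inversions_sub_eq_one_iff ht0 hct] at hws
  rw [weight_eq_ncard_inversions ht0, weight_eq_ncard_inversions ht0,
    ncard_inversions_sub_eq_one_iff hs0 hcs] at hwt
  set e := maya lam with he
  obtain ⟨x, h, hh, hsh, hone, huniq⟩ := hws
  obtain ⟨y, l, hl, htl, hone', huniq'⟩ := hwt
  have hcr : Crossed t e x (x + h) := by rw [crossed_iff]; omega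
  have hcr' : Crossed s e y (y + l) := by rw [crossed_iff]; omega
  have hth := hct.not_dvd_of_unique hs0 ht hst hsh hcr huniq
  have hsl := hcs.not_dvd_of_unique ht0 hs hst.symm htl hcr' huniq'
  -- The rows through `p` and `q - h` cross, so the unique crossing of rows fixes `q - h - p` up to
  -- sign.
  have hrow : ∀ p ∈ excess t e x (x + h), ∀ q ∈ excess t e (x + h) x,
      (q - h - p = l ∧ (s : ℤ) ∣ p - y) ∨ (p + h - q = l ∧ (s : ℤ) ∣ q - y) := by
    intro p hp q hq
    have h1 := crossed_rows hsh hp hq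
    have h2 := dvd_of_mem_excess hp hq
    rcases lt_trichotomy (q - h - p) 0 with h0 | h0 | h0
    · have h3 := huniq' (p + (q - h - p)) (-(q - h - p)) (by omega) h2.neg_right (by
        rw [add_neg_cancel_right]
        exact h1.symm)
      refine Or.inr ⟨by omega, ?_⟩
      rw [show q - y = (p + (q - h - p) - y) + h by ring]
      exact dvd_add h3.2 hsh
    · exfalso
      apply hq.2.2
      convert hp.2.1 using 1
      omega
    · exact Or.inl (huniq' p _ h0 h2 h1)
  obtain ⟨⟨p, hp⟩, ⟨q, hq⟩⟩ := hcr
  -- The minimum bounds only one excess; the rows bound both. Two different values of `p` would need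
  -- opposite signs in `hrow`, which forces `s ∣ l`.
  have hTp : excess t e x (x + h) = {p} := by
    refine Set.eq_singleton_iff_unique_mem.2 ⟨hp, fun p' hp' => ?_⟩
    obtain ⟨v, hv⟩ := hsh
    rcases hrow p hp q hq with ⟨h1, m, h2⟩ | ⟨h1, m, h2⟩ <;>
      rcases hrow p' hp' q hq with ⟨h3, n, h4⟩ | ⟨h3, n, h4⟩
    · omega
    · exact absurd ⟨n - m - v, by linear_combination h4 - h2 - hv - h1⟩ hsl
    · exact absurd ⟨m - n - v, by linear_combination h2 - h4 - hv - h3⟩ hsl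
    · omega
  have hTq : excess t e (x + h) x = {q} := by
    refine Set.eq_singleton_iff_unique_mem.2 ⟨hq, fun q' hq' => ?_⟩
    obtain ⟨v, hv⟩ := hsh
    rcases hrow p hp q hq with ⟨h1, m, h2⟩ | ⟨h1, m, h2⟩ <;>
      rcases hrow p hp q' hq' with ⟨h3, n, h4⟩ | ⟨h3, n, h4⟩
    · omega
    · exact absurd ⟨m - n + v, by linear_combination h2 - h4 + hv - h3⟩ hsl
    · exact absurd ⟨n - m + v, by linear_combination h4 - h2 + hv - h1⟩ hsl
    · omega
  have hpair : ∀ x' y', (s : ℤ) ∣ y' - x' → Crossed t e x' y' →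
      (excess t e x' y' = {p} ∧ excess t e y' x' = {q} ∧ y' - x' = h) ∨
      (excess t e x' y' = {q} ∧ excess t e y' x' = {p} ∧ x' - y' = h) := by
    intro x' y' hd hcr
    have hone : ∀ x' y', (s : ℤ) ∣ y' - x' → 0 < y' - x' → Crossed t e x' y' →
        excess t e x' y' = {p} ∧ excess t e y' x' = {q} ∧ y' - x' = h := by
      intro x' y' hd h0 hcr
      obtain ⟨h1, h2⟩ := huniq x' (y' - x') h0 hd (by rwa [add_sub_cancel])
      refine ⟨?_, ?_, h1⟩
      · rw [← hTp]
        exact excess_congr h2 (by omega)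
      · rw [← hTq]
        refine excess_congr ?_ (by omega)
        convert h2 using 1
        omega
    rcases lt_trichotomy (y' - x') 0 with h0 | h0 | h0
    · right
      obtain ⟨h1, h2, h3⟩ := hone y' x' (by rwa [dvd_sub_comm]) (by omega) hcr.symm
      exact ⟨h2, h1, h3⟩
    · exfalso
      obtain ⟨⟨z, -, hz1, hz2⟩, -⟩ := hcr
      rw [h0, add_zero] at hz2
      exact hz2 hz1
    · exact Or.inl (hone x' y' hd h0 hcr)
  refine ⟨p, q, p + h, q - h, isQuad_of_mem_excess hsh hth hp hq, by rwa [add_sub_cancel_left],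
    ?_, ?_⟩
  · intro hd
    rcases hrow p hp q hq with ⟨h1, -⟩ | ⟨h1, -⟩
    · exact hsl (h1 ▸ hd)
    · apply hsl
      rw [← h1, show p + h - q = -(q - h - p) by ring]
      exact hd.neg_right
  · intro mu hmu x₁ hx₁
    obtain ⟨hid, hns, hnt⟩ := (sameCores_iff hs0 ht0).1 hmu
    -- Every crossing pair has excesses `{p}` and `{q}`, equal in number, so changes occur only at
    -- corners of the quad.
    obtain ⟨y₁, hd, hcr, hm⟩ := hct.exists_crossed hs0 ht0 (isMaya_maya mu) hns hnt hid (by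
      intro x' y' hd hcr
      rcases hpair x' y' hd hcr with ⟨h1, h2, -⟩ | ⟨h1, h2, -⟩ <;>
        rw [h1, h2, Set.ncard_singleton, Set.ncard_singleton]) hx₁
    rcases hpair x₁ y₁ hd hcr with ⟨h1, h2, h3⟩ | ⟨h1, h2, h3⟩ <;>
      rw [h1, h2, Set.mem_singleton_iff, Set.mem_singleton_iff] at hm <;> omega

/-- If both weight differences are one, then all partitions with the same size and cores arise
from one exchange. -/
theorem exists_exchange_of_weight_sub_eq_one (hs : 1 < s) (ht : 1 < t) (hst : Nat.Coprime s t)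
    {lam : YoungDiagram} (hws : (weight s lam : ℤ) - weight s (core t lam) = 1)
    (hwt : (weight t lam : ℤ) - weight t (core s lam) = 1) :
    ∃ a b c d : ℤ, IsQuad s t (maya lam) a b c d ∧
      ∀ mu, SameCores s t lam mu → mu = lam ∨ maya mu = exchange (maya lam) a b c d := by
  obtain ⟨a, b, c, d, hQ, hca, hda, hsupp⟩ := exists_quad_of_weight_sub_eq_one hs ht hst hws hwt
  refine ⟨a, b, c, d, hQ, fun mu hmu => ?_⟩
  obtain ⟨hid, hns, hnt⟩ := (sameCores_iff (by omega) (by omega)).1 hmu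
  have hsupp := hsupp mu hmu
  obtain ⟨h1, h2, h3, h4, hab, hcd, hadd, hds, hdt⟩ := hQ
  have hac : a ≠ c := fun h => h3 (h ▸ h1)
  have had : a ≠ d := fun h => h4 (h ▸ h1)
  have hbc : b ≠ c := fun h => h3 (h ▸ h2)
  have hbd : b ≠ d := fun h => h4 (h ▸ h2)
  set g := maya mu - maya lam with hg
  have hsum : ∀ φ : ℤ → ℤ, linearCombination ℤ φ g =
      g a * φ a + g b * φ b + g c * φ c + g d * φ d := by
    intro φ
    rw [linearCombination_apply, Finsupp.sum_of_support_subset (s := {a, b, c, d})]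
    · rw [Finset.sum_insert (by simp [hab, hac, had]), Finset.sum_insert (by simp [hbc, hbd]),
        Finset.sum_insert (by simp [hcd]), Finset.sum_singleton]
      simp only [smul_eq_mul]
      ring
    · intro x hx
      rw [Finsupp.mem_support_iff, hg, Finsupp.sub_apply, sub_ne_zero] at hx
      simpa using hsupp x hx
    · simp
  -- Among the corners, only `a` and `c` lie in the row of `a`, and only `a` and `d` in its column.
  -- Hence `g c = g d = -g a`, and the zero total gives `g b = g a`.
  have hda' : (s : ℤ) ∣ b - a ↔ False := by
    refine iff_of_false (fun h => hda ?_) id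
    rw [show d - a = (b - a) - (c - a) by omega]
    exact dvd_sub h hds
  have hca' : (t : ℤ) ∣ b - a ↔ False := by
    refine iff_of_false (fun h => hca ?_) id
    rw [show c - a = (b - a) - (d - a) by omega]
    exact dvd_sub h hdt
  have e1 := hns _ (periodic_dvd_sub s a)
  have e2 := hnt _ (periodic_dvd_sub t a)
  have e3 : linearCombination ℤ (fun _ => (1 : ℤ)) g = 0 := by
    rw [hg, map_sub, linearCombination_maya_one, linearCombination_maya_one, sub_zero]
  rw [hsum] at e1 e2 e3
  simp only [sub_self, dvd_zero, if_true, hda', hca', hda, hca, hds, hdt, if_false] at e1 e2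
  have hga : g a = 0 ∨ g a = -1 := by
    have i1 := isMaya_maya lam a
    have i2 := isMaya_maya mu a
    rw [mem_beads] at h1
    rw [hg, Finsupp.sub_apply]
    simp only [occ] at *
    omega
  have hval : ∀ x, maya mu x = maya lam x + g x := by
    intro x
    rw [hg, Finsupp.sub_apply]
    ring
  have hoff : ∀ x, x ≠ a → x ≠ b → x ≠ c → x ≠ d → g x = 0 := by
    intro x x1 x2 x3 x4
    by_contra hx
    rw [hg, Finsupp.sub_apply, ← ne_eq, sub_ne_zero] at hx
    have := hsupp x hx
    tauto
  rcases hga with h0 | h0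
  · left
    refine maya_injective (Finsupp.ext fun x => ?_)
    rw [hval]
    have : g x = 0 := by
      by_cases x1 : x = a
      · rw [x1, h0]
      by_cases x2 : x = b
      · rw [x2]; omega
      by_cases x3 : x = c
      · rw [x3]; omega
      by_cases x4 : x = d
      · rw [x4]; omega
      exact hoff x x1 x2 x3 x4
    omega
  · right
    refine Finsupp.ext fun x => ?_
    rw [hval, exchange_apply]
    by_cases x1 : x = a
    · subst x1
      rw [if_pos rfl, if_neg hab.symm, if_neg hac.symm, if_neg had.symm]
      omega
    by_cases x2 : x = b
    · subst x2
      rw [if_pos rfl, if_neg hab, if_neg hbc.symm, if_neg hbd.symm]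
      omega
    by_cases x3 : x = c
    · subst x3
      rw [if_pos rfl, if_neg hac, if_neg hbc, if_neg hcd.symm]
      omega
    by_cases x4 : x = d
    · subst x4
      rw [if_pos rfl, if_neg had, if_neg hbd, if_neg hcd]
      omega
    rw [hoff x x1 x2 x3 x4, if_neg (Ne.symm x1), if_neg (Ne.symm x2), if_neg (Ne.symm x3),
      if_neg (Ne.symm x4)]
    ring

end

/-! ### Conjugation and conclusion -/

theorem card_transpose (lam : YoungDiagram) : lam.transpose.card = lam.card := by
  have h := linearCombination_maya_id lam.transpose
  rw [linearCombination_maya_transpose, linearCombination_sub_fun, linearCombination_maya_id] at h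
  have h1 : linearCombination ℤ (fun _ => (-1 : ℤ)) (maya lam) = 0 := by
    simp [linearCombination_maya]
  rw [h1] at h
  omega

theorem sameCores_transpose {s t : ℕ} (hs : 0 < s) (ht : 0 < t) {lam mu : YoungDiagram}
    (h1 : IsSelfConjugate (core s lam)) (h2 : IsSelfConjugate (core t lam))
    (h : SameCores s t lam mu) : SameCores s t lam mu.transpose := by
  refine ⟨by rw [card_transpose, h.1], ?_, ?_⟩
  · rw [core_transpose hs, h.2.1, h1]
  · rw [core_transpose ht, h.2.2, h2]

theorem theorem5p14 (s t : ℕ) (hs : 1 < s) (ht : 1 < t) (hst : Nat.Coprime s t)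
    (lam : YoungDiagram) :
    (lam ≠ lam.transpose ∧
      {mu : YoungDiagram | mu.card = lam.card ∧ core s mu = core s lam ∧
        core t mu = core t lam} = {lam, lam.transpose}) ↔
    (IsSelfConjugate (core s lam) ∧ IsSelfConjugate (core t lam) ∧
      (weight s lam : ℤ) - (weight s (core t lam) : ℤ) = 1 ∧
      (weight t lam : ℤ) - (weight t (core s lam) : ℤ) = 1) := by
  have hs0 : 0 < s := by omega
  have ht0 : 0 < t := by omega
  constructor
  · rintro ⟨hne, hset⟩
    have hmem : ∀ mu, SameCores s t lam mu ↔ mu = lam ∨ mu = lam.transpose := fun mu => by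
      simpa [SameCores] using Set.ext_iff.1 hset mu
    have hsame := (hmem lam.transpose).2 (Or.inr rfl)
    refine ⟨?_, ?_, ?_, ?_⟩
    · rw [IsSelfConjugate, ← core_transpose hs0, hsame.2.1]
    · rw [IsSelfConjugate, ← core_transpose ht0, hsame.2.2]
    · exact weight_sub_weight_core_eq_one hs ht hst hne.symm hsame fun mu => (hmem mu).1
    · exact weight_sub_weight_core_eq_one ht hs hst.symm hne.symm hsame.symm_st fun mu h =>
        (hmem mu).1 h.symm_st
  · rintro ⟨h1, h2, hws, hwt⟩
    obtain ⟨a, b, c, d, hQ, hall⟩ := exists_exchange_of_weight_sub_eq_one hs ht hst hws hwt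
    obtain ⟨mu, hmu, hmune, hmus⟩ := hQ.exists_eq_exchange hs0 ht0
    have hall' : ∀ nu, SameCores s t lam nu → nu = lam ∨ nu = mu := fun nu hnu =>
      (hall nu hnu).imp_right fun h => maya_injective (h.trans hmu.symm)
    have hself : SameCores s t lam lam := ⟨rfl, rfl, rfl⟩
    have hT := sameCores_transpose hs0 ht0 h1 h2 hself
    -- If `lam` were self-conjugate, so would be `mu`, the only other candidate. Then `x ↦ -1 - x`
    -- maps the lost beads `a`, `b` to the gained positions `c`, `d`; with `a + b = c + d` this
    -- gives `a + b = -1`, so the bead `b = -1 - a` would be a gap.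
    have hne : lam ≠ lam.transpose := by
      intro hlam
      have hmuT : mu.transpose = mu := by
        refine (hall' _ (sameCores_transpose hs0 ht0 h1 h2 hmus)).resolve_left fun h => hmune ?_
        rw [← mu.transpose_transpose, h, ← hlam]
      have hanti : ∀ x, maya mu x - maya lam x = -(maya mu (-1 - x) - maya lam (-1 - x)) := by
        intro x
        conv_lhs => rw [← hmuT, hlam, maya_transpose, maya_transpose]
        ring
      obtain ⟨b1, b2, g1, g2, hab, hcd, hadd, -⟩ := hQ
      have hac : a ≠ c := fun h => g1 (h ▸ b1)
      have had : a ≠ d := fun h => g2 (h ▸ b1)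
      have hbc : b ≠ c := fun h => g1 (h ▸ b2)
      have hbd : b ≠ d := fun h => g2 (h ▸ b2)
      have hgap : ∀ y, maya mu y - maya lam y = 1 → y = c ∨ y = d := by
        intro y hy
        by_contra! hn
        rw [hmu, exchange_apply, if_neg hn.1.symm, if_neg hn.2.symm] at hy
        split_ifs at hy <;> omega
      have ha : maya mu a - maya lam a = -1 := by
        rw [hmu, exchange_apply, if_pos rfl, if_neg hab.symm, if_neg hac.symm, if_neg had.symm]
        ring
      have hb : maya mu b - maya lam b = -1 := by
        rw [hmu, exchange_apply, if_neg hab, if_pos rfl, if_neg hbc.symm, if_neg hbd.symm]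
        ring
      have ha' := hgap (-1 - a) (by have := hanti a; omega)
      have hb' := hgap (-1 - b) (by have := hanti b; omega)
      omega
    have hlamT : lam.transpose = mu := (hall' _ hT).resolve_left hne.symm
    refine ⟨hne, Set.ext fun nu => ?_⟩
    rw [Set.mem_insert_iff, Set.mem_singleton_iff, hlamT]
    constructor
    · exact fun h => hall' nu h
    · rintro (rfl | rfl)
      · exact hself
      · exact hmus
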